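/- **Language.** A signature $\sigma=(\sigma^\nu,\sigma^\pi,\sigma^\alpha)$ consists of a countably infinite set $\sigma^\nu$ of constants, a countable set $\sigma^\pi$ of predicate symbols, and an arity function $\sigma^\alpha:\sigma^\pi\to\mathbb N_{>0}$. A term is a constant or one of the variables $v_0,v_1,\dots$. Formulas are generated by $$\phi::=P(t_1,\dots,t_n)\mid s\equiv t\mid\bot\mid(\phi\land\phi)\mid(\phi\lor\phi)\mid(\phi\to\phi)\mid\Box\phi\mid\Diamond\phi\mid\forall x\,\phi\mid\exists x\,\phi ,$$ with $\neg\phi:=\phi\to\bot$ and $\top:=\neg\bot$. A sentence is a formula without free variables. If $\phi$ has no free variable other than $x$, then $\phi(c)$ denotes the result of replacing the free occurrences of $x$ by the constant $c$. $\phi^c_x$ denotes the result of replacing every occurrence of $c$ in $\phi$ by $x$; $x$ is substitutable for $c$ in $\phi$ if no occurrence of $c$ lies in the scope of a quantifier binding $x$. **The logic $\mathsf{FOFS}$.** It is the following Hilbert system for sentences, where $c,c_1,c_2$ are constants, $\phi,\psi$ are sentences, and a formula written $\phi(x)$ or $\psi(x)$ has no free variable other than $x$ (it need not contain $x$). Axioms: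 all substitution instances of theorems of intuitionistic propositional calculus; $\Box(\phi\land\psi)\leftrightarrow(\Box\phi\land\Box\psi)$; $\Box\top$; $\Diamond(\phi\lor\psi)\leftrightarrow(\Diamond\phi\lor\Diamond\psi)$; $\neg\Diamond\bot$; $(\Diamond\phi\to\Box\psi)\to\Box(\phi\to\psi)$; $\Diamond(\phi\to\psi)\to(\Box\phi\to\Diamond\psi)$; $\forall x\,\phi(x)\to\phi(c)$; $\phi(c)\to\exists x\,\phi(x)$; $\forall x(\phi(x)\to\psi)\to(\exists x\,\phi(x)\to\psi)$; $\forall x(\phi\to\psi(x))\to(\phi\to\forall x\,\psi(x))$; $c\equiv c$; $c_1\equiv c_2\to(\phi(c_1)\to\phi(c_2))$ for $\phi(x)$ containing neither $\Box$ nor $\Diamond$. Rules: modus ponens; from $\phi$ infer $\forall x\,\phi^c_x$, provided $x$ is substitutable for $c$ in $\phi$; from $\phi\to\psi$ infer $\Box\phi\to\Box\psi$ and $\Diamond\phi\to\Diamond\psi$. **The logic $\mathsf{FOFS\text{-}S4}$.** It is obtained by adding to this system, for all sentences $\phi$, the axioms $\Box\phi\to\phi$, $\phi\to\Diamond\phi$,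 $\Box\phi\to\Box\Box\phi$ and $\Diamond\Diamond\phi\to\Diamond\phi$. For a set $\Gamma$ of sentences, $\Gamma\vdash\phi$ means that $\bigwedge_i\gamma_i\to\phi$ is a theorem of $\mathsf{FOFS\text{-}S4}$ for some finite family $\gamma_i\in\Gamma$ (the empty conjunction being $\top$). **Frames and models.** A frame consists of a set $W$ with a partial order $\preccurlyeq$ and a binary relation $R$ such that (FC1) if $wRv\preccurlyeq v'$ then $w\preccurlyeq w'Rv'$ for some $w'$, and (FC2) if $w\preccurlyeq w'$ and $wRv$ then $v\preccurlyeq v'$ and $w'Rv'$ for some $v'$; together with a set $D(w)$ for each $w\in W$, where $D(w)\subseteq D(w')$ whenever $w\preccurlyeq w'$ or $wRw'$, and an equivalence relation $\sim_w$ on each $D(w)$ such that $a\sim_w b$ and $w\preccurlyeq w'$ imply $a\sim_{w'}b$. A model on a frame assigns to each constant $c$ an element $I(c)\in\bigcap_{w}D(w)$ and to each world $w$ and $n$-ary predicate $P$ a set $I_w(P)\subseteq D(w)^n$ that is invariant under $\sim_w$ in each argument and satisfies $I_w(P)\subseteq I_{w'}(P)$ whenever $w\preccurlyeq w'$. Truth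 $w\Vdash_g\phi$, for an assignment $g$ of elements of $D(w)$ to the variables, is defined as follows. $w\Vdash_g P(\bar t)$ iff the tuple of denotations of $\bar t$ lies in $I_w(P)$; $w\Vdash_g s\equiv t$ iff the denotations of $s,t$ are $\sim_w$-related; $\bot$ is never true; $\land,\lor$ are evaluated at $w$; $w\Vdash_g\phi\to\psi$ iff for all $w'\succcurlyeq w$, $w'\Vdash_g\phi$ implies $w'\Vdash_g\psi$; $w\Vdash_g\Box\phi$ iff $v\Vdash_g\phi$ whenever $w\preccurlyeq w'Rv$; $w\Vdash_g\Diamond\phi$ iff $v\Vdash_g\phi$ for some $v$ with $wRv$; $w\Vdash_g\forall x\,\phi$ iff $w'\Vdash_{g[x:=a]}\phi$ for all $w'\succcurlyeq w$ and $a\in D(w')$; $w\Vdash_g\exists x\,\phi$ iff $w\Vdash_{g[x:=a]}\phi$ for some $a\in D(w)$. A sentence holds at $w$ if it is true at $w$ under every such assignment. **Theorem (completeness of $\mathsf{FOFS\text{-}S4}$).** $\mathsf{FOFS\text{-}S4}$ is (strongly) complete with respect to the class of frames whose modal relation $R$ is a quasi-order: for every signature, every set $\Gamma$ of sentences and every sentence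 $\phi$, if $\phi$ holds at every world at which all of $\Gamma$ holds, in every model on a frame with reflexive and transitive $R$, then $\Gamma\vdash\phi$. -/

import Mathlib

universe u

namespace FOFS

/-- A signature: a countably infinite set of constants, countably many predicate symbols,
and a positive arity for each predicate symbol. -/
structure Signature where
  Const : Type u
  Pred : Type u
  arity : Pred → ℕ
  arity_pos : ∀ P, 0 < arity P
  const_countable : Countable Const
  const_infinite : Infinite Const
  pred_countable : Countable Pred

attribute [instance] Signature.const_countable Signature.const_infinite Signature.pred_countable

/-- Terms are variables `v₀, v₁, …` or constants. -/
inductive Term (σ : Signature.{u}) : Type u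
  | var (x : ℕ) : Term σ
  | const (c : σ.Const) : Term σ

/-- First-order modal formulas with named variables. -/
inductive Formula (σ : Signature.{u}) : Type u
  | pred (P : σ.Pred) (t : Fin (σ.arity P) → Term σ) : Formula σ
  | eq (s t : Term σ) : Formula σ
  | bot : Formula σ
  | and (φ ψ : Formula σ) : Formula σ
  | or (φ ψ : Formula σ) : Formula σ
  | imp (φ ψ : Formula σ) : Formula σ
  | box (φ : Formula σ) : Formula σ
  | dia (φ : Formula σ) : Formula σ
  | all (x : ℕ) (φ : Formula σ) : Formula σ
  | ex (x : ℕ) (φ : Formula σ) : Formula σ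

namespace Term

variable {σ : Signature.{u}}

/-- The variables occurring in a term. -/
def vars : Term σ → Finset ℕ
  | var x => {x}
  | const _ => ∅

/-- Replace the variable `x` by the constant `c`. -/
def inst (x : ℕ) (c : σ.Const) : Term σ → Term σ
  | var y => if y = x then const c else var y
  | const d => const d

open Classical in
/-- Replace the constant `c` by the variable `x`. -/
noncomputable def abstr (c : σ.Const) (x : ℕ) : Term σ → Term σ
  | var y => var y
  | const d => if d = c then var x else const d

end Term

namespace Formula

variable {σ : Signature.{u}}

/-- Negation `φ → ⊥`. -/
def neg (φ : Formula σ) : Formula σ := imp φ bot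

/-- Truth `¬⊥`. -/
def top : Formula σ := neg bot

/-- The biconditional. -/
def iff (φ ψ : Formula σ) : Formula σ := and (imp φ ψ) (imp ψ φ)

/-- Conjunction of a finite list; the empty conjunction is `⊤`. -/
def bigAnd : List (Formula σ) → Formula σ
  | [] => top
  | φ :: l => and φ (bigAnd l)

/-- The free variables of a formula. -/
def freeVars : Formula σ → Finset ℕ
  | pred _ t => Finset.univ.biUnion fun i => (t i).vars
  | eq s t => s.vars ∪ t.vars
  | bot => ∅
  | and φ ψ => φ.freeVars ∪ ψ.freeVars
  | or φ ψ => φ.freeVars ∪ ψ.freeVars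
  | imp φ ψ => φ.freeVars ∪ ψ.freeVars
  | box φ => φ.freeVars
  | dia φ => φ.freeVars
  | all x φ => φ.freeVars.erase x
  | ex x φ => φ.freeVars.erase x

/-- A sentence is a formula without free variables. -/
def IsSentence (φ : Formula σ) : Prop := φ.freeVars = ∅

/-- `φ.inst x c` is `φ(c)`: each free occurrence of `x` is replaced by the constant `c`. -/
def inst (x : ℕ) (c : σ.Const) : Formula σ → Formula σ
  | pred P t => pred P fun i => (t i).inst x c
  | eq s t => eq (s.inst x c) (t.inst x c)
  | bot => bot
  | and φ ψ => and (φ.inst x c) (ψ.inst x c)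
  | or φ ψ => or (φ.inst x c) (ψ.inst x c)
  | imp φ ψ => imp (φ.inst x c) (ψ.inst x c)
  | box φ => box (φ.inst x c)
  | dia φ => dia (φ.inst x c)
  | all y φ => all y (if y = x then φ else φ.inst x c)
  | ex y φ => ex y (if y = x then φ else φ.inst x c)

/-- `φ.abstr c x` is the result of replacing each occurrence of the constant `c` in `φ`
by the variable `x`. -/
noncomputable def abstr (c : σ.Const) (x : ℕ) : Formula σ → Formula σ
  | pred P t => pred P fun i => (t i).abstr c x
  | eq s t => eq (s.abstr c x) (t.abstr c x)
  | bot => bot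
  | and φ ψ => and (φ.abstr c x) (ψ.abstr c x)
  | or φ ψ => or (φ.abstr c x) (ψ.abstr c x)
  | imp φ ψ => imp (φ.abstr c x) (ψ.abstr c x)
  | box φ => box (φ.abstr c x)
  | dia φ => dia (φ.abstr c x)
  | all y φ => all y (φ.abstr c x)
  | ex y φ => ex y (φ.abstr c x)

/-- The constant `c` occurs in `φ`. -/
def HasConst (c : σ.Const) : Formula σ → Prop
  | pred _ t => ∃ i, t i = Term.const c
  | eq s t => s = Term.const c ∨ t = Term.const c
  | bot => False
  | and φ ψ => φ.HasConst c ∨ ψ.HasConst c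
  | or φ ψ => φ.HasConst c ∨ ψ.HasConst c
  | imp φ ψ => φ.HasConst c ∨ ψ.HasConst c
  | box φ => φ.HasConst c
  | dia φ => φ.HasConst c
  | all _ φ => φ.HasConst c
  | ex _ φ => φ.HasConst c

/-- The variable `x` is substitutable for the constant `c`: no occurrence of `c` lies in the
scope of a quantifier binding `x`. -/
def Substitutable (x : ℕ) (c : σ.Const) : Formula σ → Prop
  | pred _ _ => True
  | eq _ _ => True
  | bot => True
  | and φ ψ => φ.Substitutable x c ∧ ψ.Substitutable x c
  | or φ ψ => φ.Substitutable x c ∧ ψ.Substitutable x c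
  | imp φ ψ => φ.Substitutable x c ∧ ψ.Substitutable x c
  | box φ => φ.Substitutable x c
  | dia φ => φ.Substitutable x c
  | all y φ => (φ.HasConst c → y ≠ x) ∧ φ.Substitutable x c
  | ex y φ => (φ.HasConst c → y ≠ x) ∧ φ.Substitutable x c

/-- The formula contains neither `□` nor `◇`. -/
def ModalFree : Formula σ → Prop
  | pred _ _ => True
  | eq _ _ => True
  | bot => True
  | and φ ψ => φ.ModalFree ∧ ψ.ModalFree
  | or φ ψ => φ.ModalFree ∧ ψ.ModalFree
  | imp φ ψ => φ.ModalFree ∧ ψ.ModalFree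
  | box _ => False
  | dia _ => False
  | all _ φ => φ.ModalFree
  | ex _ φ => φ.ModalFree

end Formula

/-- Propositional formulas. -/
inductive PropForm : Type
  | atom (n : ℕ) : PropForm
  | bot : PropForm
  | and (A B : PropForm) : PropForm
  | or (A B : PropForm) : PropForm
  | imp (A B : PropForm) : PropForm

/-- Theorems of the intuitionistic propositional calculus. -/
inductive IPC : PropForm → Prop
  | k (A B) : IPC (.imp A (.imp B A))
  | s (A B C) : IPC (.imp (.imp A (.imp B C)) (.imp (.imp A B) (.imp A C)))
  | and_left (A B) : IPC (.imp (.and A B) A)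
  | and_right (A B) : IPC (.imp (.and A B) B)
  | and_intro (A B) : IPC (.imp A (.imp B (.and A B)))
  | or_left (A B) : IPC (.imp A (.or A B))
  | or_right (A B) : IPC (.imp B (.or A B))
  | or_elim (A B C) : IPC (.imp (.imp A C) (.imp (.imp B C) (.imp (.or A B) C)))
  | ex_falso (A) : IPC (.imp .bot A)
  | mp {A B} : IPC (.imp A B) → IPC A → IPC B

/-- Substitution of formulas for the atoms of a propositional formula. -/
def PropForm.subst {σ : Signature.{u}} (s : ℕ → Formula σ) : PropForm → Formula σ
  | atom n => s n
  | bot => .bot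
  | and A B => .and (A.subst s) (B.subst s)
  | or A B => .or (A.subst s) (B.subst s)
  | imp A B => .imp (A.subst s) (B.subst s)

section ProofSystem

variable {σ : Signature.{u}}

open Formula

/-- `Provable Ax φ`: `φ` is a theorem of `FOFS ⊕ Ax`, the Hilbert system of first-order
Fischer Servi logic with the sentences in `Ax` as additional axioms. -/
inductive Provable (Ax : Set (Formula σ)) : Formula σ → Prop
  | ax {φ} : φ ∈ Ax → Provable Ax φ
  | int (A : PropForm) (s : ℕ → Formula σ) : IPC A → (∀ n, (s n).IsSentence) →
      Provable Ax (A.subst s)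
  | box_and (φ ψ : Formula σ) : φ.IsSentence → ψ.IsSentence →
      Provable Ax (iff (box (and φ ψ)) (and (box φ) (box ψ)))
  | box_top : Provable Ax (box top)
  | dia_or (φ ψ : Formula σ) : φ.IsSentence → ψ.IsSentence →
      Provable Ax (iff (dia (or φ ψ)) (or (dia φ) (dia ψ)))
  | dia_bot : Provable Ax (neg (dia bot))
  | fs1 (φ ψ : Formula σ) : φ.IsSentence → ψ.IsSentence →
      Provable Ax (imp (imp (dia φ) (box ψ)) (box (imp φ ψ)))
  | fs2 (φ ψ : Formula σ) : φ.IsSentence → ψ.IsSentence →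
      Provable Ax (imp (dia (imp φ ψ)) (imp (box φ) (dia ψ)))
  | univ (x : ℕ) (c : σ.Const) (φ : Formula σ) : φ.freeVars ⊆ {x} →
      Provable Ax (imp (all x φ) (φ.inst x c))
  | exist (x : ℕ) (c : σ.Const) (φ : Formula σ) : φ.freeVars ⊆ {x} →
      Provable Ax (imp (φ.inst x c) (ex x φ))
  | all_ant (x : ℕ) (φ ψ : Formula σ) : φ.freeVars ⊆ {x} → ψ.IsSentence →
      Provable Ax (imp (all x (imp φ ψ)) (imp (ex x φ) ψ))
  | all_con (x : ℕ) (φ ψ : Formula σ) : φ.IsSentence → ψ.freeVars ⊆ {x} →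
      Provable Ax (imp (all x (imp φ ψ)) (imp φ (all x ψ)))
  | id_refl (c : σ.Const) : Provable Ax (eq (.const c) (.const c))
  | id_sub (c₁ c₂ : σ.Const) (x : ℕ) (φ : Formula σ) : φ.freeVars ⊆ {x} → φ.ModalFree →
      Provable Ax (imp (eq (.const c₁) (.const c₂)) (imp (φ.inst x c₁) (φ.inst x c₂)))
  | mp {φ ψ : Formula σ} : Provable Ax (imp φ ψ) → Provable Ax φ → Provable Ax ψ
  | gen {φ : Formula σ} (c : σ.Const) (x : ℕ) : φ.Substitutable x c →
      Provable Ax φ → Provable Ax (all x (φ.abstr c x))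
  | reg_box {φ ψ : Formula σ} : Provable Ax (imp φ ψ) → Provable Ax (imp (box φ) (box ψ))
  | reg_dia {φ ψ : Formula σ} : Provable Ax (imp φ ψ) → Provable Ax (imp (dia φ) (dia ψ))

/-- The axioms `□φ → φ`, `φ → ◇φ`, `□φ → □□φ` and `◇◇φ → ◇φ`, for all sentences `φ`. -/
def S4Axioms (σ : Signature.{u}) : Set (Formula σ) :=
  {χ | ∃ φ : Formula σ, φ.IsSentence ∧
    (χ = imp (box φ) φ ∨ χ = imp φ (dia φ) ∨
      χ = imp (box φ) (box (box φ)) ∨ χ = imp (dia (dia φ)) (dia φ))}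

/-- `Γ ⊢ φ` in `FOFS ⊕ Ax`: the conjunction of finitely many members of `Γ` provably
implies `φ`. -/
def Derivable (Ax Γ : Set (Formula σ)) (φ : Formula σ) : Prop :=
  ∃ l : List (Formula σ), (∀ γ ∈ l, γ ∈ Γ) ∧ Provable Ax (imp (bigAnd l) φ)

end ProofSystem

/-- A frame: a Fischer Servi frame (a partial order `le` and a modal relation `rel` with the two
compatibility conditions) together with a domain system, that is, for each world `w` a set `dom w`
and an equivalence relation `eqv w` on it. -/
structure Frame where
  World : Type u
  le : World → World → Prop
  rel : World → World → Prop
  le_refl : ∀ w, le w w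
  le_trans : ∀ w v z, le w v → le v z → le w z
  le_antisymm : ∀ w v, le w v → le v w → w = v
  fc1 : ∀ w v v', rel w v → le v v' → ∃ w', le w w' ∧ rel w' v'
  fc2 : ∀ w w' v, le w w' → rel w v → ∃ v', le v v' ∧ rel w' v'
  Elem : Type u
  dom : World → Set Elem
  dom_le : ∀ w w', le w w' → dom w ⊆ dom w'
  dom_rel : ∀ w v, rel w v → dom w ⊆ dom v
  eqv : World → Elem → Elem → Prop
  eqv_dom : ∀ w a b, eqv w a b → a ∈ dom w ∧ b ∈ dom w
  eqv_refl : ∀ w, ∀ a ∈ dom w, eqv w a a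
  eqv_symm : ∀ w a b, eqv w a b → eqv w b a
  eqv_trans : ∀ w a b c, eqv w a b → eqv w b c → eqv w a c
  eqv_le : ∀ w w' a b, le w w' → eqv w a b → eqv w' a b

/-- The class of frames whose modal relation is a quasi-order. -/
def S4Frames : Set Frame.{u} :=
  {F | (∀ w, F.rel w w) ∧ ∀ w v z, F.rel w v → F.rel v z → F.rel w z}

/-- A model: a frame with an interpretation of the constants and predicate symbols. -/
structure Model (σ : Signature.{u}) extends Frame.{u} where
  constI : σ.Const → Elem
  constI_mem : ∀ c w, constI c ∈ dom w
  predI : World → (P : σ.Pred) → Set (Fin (σ.arity P) → Elem)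
  predI_dom : ∀ w P, ∀ a ∈ predI w P, ∀ i, a i ∈ dom w
  predI_le : ∀ w w' P, le w w' → predI w P ⊆ predI w' P
  predI_congr : ∀ w P a b, (∀ i, eqv w (a i) (b i)) → a ∈ predI w P → b ∈ predI w P

namespace Model

variable {σ : Signature.{u}} (M : Model σ)

/-- `g` is a `w`-variable assignment. -/
def IsAssignment (w : M.World) (g : ℕ → M.Elem) : Prop := ∀ x, g x ∈ M.dom w

/-- The denotation of a term. -/
def denote (g : ℕ → M.Elem) : Term σ → M.Elem
  | .var x => g x
  | .const c => M.constI c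

/-- Truth of a formula at a world relative to a variable assignment. -/
def Forces : M.World → (ℕ → M.Elem) → Formula σ → Prop
  | w, g, .pred P t => (fun i => M.denote g (t i)) ∈ M.predI w P
  | w, g, .eq s t => M.eqv w (M.denote g s) (M.denote g t)
  | _, _, .bot => False
  | w, g, .and φ ψ => Forces w g φ ∧ Forces w g ψ
  | w, g, .or φ ψ => Forces w g φ ∨ Forces w g ψ
  | w, g, .imp φ ψ => ∀ w', M.le w w' → Forces w' g φ → Forces w' g ψ
  | w, g, .box φ => ∀ w' v, M.le w w' → M.rel w' v → Forces v g φ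
  | w, g, .dia φ => ∃ v, M.rel w v ∧ Forces v g φ
  | w, g, .all x φ => ∀ w', M.le w w' → ∀ a ∈ M.dom w', Forces w' (Function.update g x a) φ
  | w, g, .ex x φ => ∃ a ∈ M.dom w, Forces w (Function.update g x a) φ

/-- `φ` holds at `w`: it is true there under every `w`-variable assignment. -/
def Holds (w : M.World) (φ : Formula σ) : Prop :=
  ∀ g, M.IsAssignment w g → M.Forces w g φ

end Model

/-- `Γ ⊩ φ` over the frame class `C`: at every world of every model based on a frame in `C`,
if all of `Γ` holds then `φ` holds. -/
def Entails {σ : Signature.{u}} (C : Set Frame.{u}) (Γ : Set (Formula σ)) (φ : Formula σ) : Prop :=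
  ∀ M : Model σ, M.toFrame ∈ C → ∀ w : M.World, (∀ γ ∈ Γ, M.Holds w γ) → M.Holds w φ

end FOFS

/-! The proof builds a canonical model in which a world is not a single theory but a node in a whole
tree of theories. A `Fam` assigns to every finite list of constants a domain and, if the node is
active, a deductively closed theory. Necessities pass from parent to child, and whatever a child
asserts in its parent's language is possible at the parent. The order keeps the node and enlarges
the family; the modal relation keeps the family and moves to a descendant. FC1 and FC2 then hold at
once, by taking the required node in the larger family, and the modal relation is a quasi-order
because "is a suffix of" is one. The S4 axioms carry `□` and `◇` along paths of any length,
including length zero.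

The core is that a family can be enlarged at one node `y` (`Fam.Extension.fam`). Going from `y` to
the root, each ancestor receives `◇α` for the sentences `α` of its changed child that lie in its own
language; every node off this path then receives the `β` with `□β` at its parent. The axiom `(◇φ →
□ψ) → □(φ → ψ)` preserves the box condition on the path, and `◇(φ → ψ) → (□φ → ◇ψ)` the diamond
condition off it. As domains grow from parent to child, the latter needs an interpolant:
`Der.exists_restrict` quantifies the foreign constants of a sentence away existentially.

Two facts control an enlargement: if it is conservative at `y`, it is conservative everywhere
(`Fam.Extension.conservative`), and propagation preserves intersections (`Fam.Extension.inter`).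
Hence disjunctions and existential sentences anywhere in the tree can be given witnesses while a
chosen sentence stays out of a chosen theory; a possibility gets a new child. Countably many such
steps give a saturated family (`Fam.exists_saturated`).

In the truth lemma `forces_canonicalModel`, saturation handles `∨`, `∃` and `◇`, while refuting `→`,
`∀` or `□` requires a larger family. Every world therefore leaves infinitely many constants unused.
To have such constants at the outset, the constants are first renamed by an injection with
co-infinite range, which is harmless because a permutation undoes it on any finite set of constants
(`derivable_of_der_rename`). -/

namespace FOFS

/-! ### Substitution and renaming of constants in terms -/

namespace Term

variable {σ : Signature.{u}}

/-- Rename the constants of a term. -/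
def rename (f : σ.Const → σ.Const) : Term σ → Term σ
  | var y => var y
  | const d => const (f d)

/-- Replace each variable on which `g` is defined by a constant. -/
def sub (g : ℕ → Option σ.Const) : Term σ → Term σ
  | var y => (g y).elim (var y) const
  | const d => const d

theorem vars_inst (x : ℕ) (c : σ.Const) (t : Term σ) : (t.inst x c).vars = t.vars.erase x := by
  cases t with
  | var y =>
    by_cases h : y = x
    · simp [inst, vars, h]
    · simp [inst, vars, h, Finset.erase_eq_of_notMem, Ne.symm h]
  | const d => simp [inst, vars]

theorem vars_abstr (c : σ.Const) (x : ℕ) (t : Term σ) :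
    (t.abstr c x).vars ⊆ insert x t.vars := by
  cases t with
  | var y => simp [abstr, vars]
  | const d => by_cases h : d = c <;> simp [abstr, vars, h]

theorem eq_const_of_inst {x : ℕ} {c d : σ.Const} {t : Term σ} (h : t.inst x c = const d) :
    t = const d ∨ d = c := by
  cases t with
  | var y =>
    by_cases hy : y = x
    · simp only [inst, hy, if_true, const.injEq] at h
      exact .inr h.symm
    · simp [inst, hy] at h
  | const e => exact .inl h

theorem eq_const_of_abstr {x : ℕ} {c d : σ.Const} {t : Term σ} (h : t.abstr c x = const d) :
    t = const d ∧ d ≠ c := by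
  cases t with
  | var y => simp [abstr] at h
  | const e =>
    by_cases he : e = c
    · simp [abstr, he] at h
    · simp only [abstr, he, if_false, const.injEq] at h
      subst h
      exact ⟨rfl, he⟩

theorem abstr_of_ne {c : σ.Const} (x : ℕ) {t : Term σ} (h : t ≠ const c) : t.abstr c x = t := by
  cases t with
  | var y => rfl
  | const d =>
    have : d ≠ c := fun e => h (by rw [e])
    simp [abstr, this]

theorem inst_abstr {c : σ.Const} {x : ℕ} {t : Term σ} (h : x ∉ t.vars) :
    (t.abstr c x).inst x c = t := by
  cases t with
  | var y =>
    have : y ≠ x := by simpa [vars, eq_comm] using h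
    simp [abstr, inst, this]
  | const d => by_cases hd : d = c <;> simp [abstr, inst, hd]

theorem abstr_inst {c : σ.Const} {x : ℕ} {t : Term σ} (h : t ≠ const c) :
    (t.inst x c).abstr c x = t := by
  cases t with
  | var y => by_cases hy : y = x <;> simp [abstr, inst, hy]
  | const d =>
    have : d ≠ c := fun e => h (by rw [e])
    simp [abstr, inst, this]

theorem inst_sub (x : ℕ) (a : σ.Const) (g : ℕ → Option σ.Const) (t : Term σ) :
    (t.sub (Function.update g x none)).inst x a = t.sub (Function.update g x (some a)) := by
  cases t with
  | var y =>
    by_cases hy : y = x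
    · subst hy; simp [sub, inst]
    · cases h : g y <;> simp [sub, inst, hy, h]
  | const d => rfl

theorem mem_vars_sub {g : ℕ → Option σ.Const} {t : Term σ} {v : ℕ} (h : v ∈ (t.sub g).vars) :
    v ∈ t.vars ∧ g v = none := by
  cases t with
  | var y =>
    cases hg : g y with
    | none =>
      simp only [sub, hg, Option.elim, vars, Finset.mem_singleton] at h ⊢
      subst h
      exact ⟨rfl, hg⟩
    | some a => simp [sub, hg, vars] at h
  | const d => simp [sub, vars] at h

theorem eq_const_of_sub {g : ℕ → Option σ.Const} {t : Term σ} {c : σ.Const}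
    (h : t.sub g = const c) : t = const c ∨ ∃ v, g v = some c := by
  cases t with
  | var y =>
    cases hg : g y with
    | none => simp [sub, hg] at h
    | some a =>
      simp only [sub, hg, Option.elim, const.injEq] at h
      subst h
      exact .inr ⟨y, hg⟩
  | const d => exact .inl h

theorem sub_eq_self {g : ℕ → Option σ.Const} {t : Term σ} (h : ∀ v ∈ t.vars, g v = none) :
    t.sub g = t := by
  cases t with
  | var y => simp [sub, h y (by simp [vars])]
  | const d => rfl

theorem vars_rename (f : σ.Const → σ.Const) (t : Term σ) : (t.rename f).vars = t.vars := by
  cases t <;> rfl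

theorem rename_eq_const {f : σ.Const → σ.Const} {t : Term σ} {c : σ.Const} :
    t.rename f = const c ↔ ∃ d, t = const d ∧ f d = c := by
  cases t <;> simp [rename]

theorem rename_inst (f : σ.Const → σ.Const) (x : ℕ) (c : σ.Const) (t : Term σ) :
    (t.inst x c).rename f = (t.rename f).inst x (f c) := by
  cases t with
  | var y => by_cases hy : y = x <;> simp [rename, inst, hy]
  | const d => rfl

theorem rename_abstr {f : σ.Const → σ.Const} (hf : Function.Injective f) (c : σ.Const) (x : ℕ)
    (t : Term σ) : (t.abstr c x).rename f = (t.rename f).abstr (f c) x := by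
  cases t with
  | var y => rfl
  | const d => by_cases hd : d = c <;> simp [rename, abstr, hd, hf.eq_iff]

theorem rename_rename (f g : σ.Const → σ.Const) (t : Term σ) :
    (t.rename g).rename f = t.rename (f ∘ g) := by
  cases t <;> rfl

theorem rename_eq_self {f : σ.Const → σ.Const} {t : Term σ} (h : ∀ c, t = const c → f c = c) :
    t.rename f = t := by
  cases t with
  | var y => rfl
  | const d => simp [rename, h d rfl]

instance : Countable (Term σ) := by
  have : Function.Surjective (Sum.elim var const : ℕ ⊕ σ.Const → Term σ) := by
    rintro (x | c)
    · exact ⟨.inl x, rfl⟩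
    · exact ⟨.inr c, rfl⟩
  exact this.countable

end Term

/-! ### Substitution and renaming of constants in formulas -/

namespace Formula

variable {σ : Signature.{u}}

/-- Rename the constants of a formula. -/
def rename (f : σ.Const → σ.Const) : Formula σ → Formula σ
  | pred P t => pred P fun i => (t i).rename f
  | eq s t => eq (s.rename f) (t.rename f)
  | bot => bot
  | and φ ψ => and (φ.rename f) (ψ.rename f)
  | or φ ψ => or (φ.rename f) (ψ.rename f)
  | imp φ ψ => imp (φ.rename f) (ψ.rename f)
  | box φ => box (φ.rename f)
  | dia φ => dia (φ.rename f)
  | all y φ => all y (φ.rename f)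
  | ex y φ => ex y (φ.rename f)

/-- Replace each free variable on which `g` is defined by a constant. -/
def sub (g : ℕ → Option σ.Const) : Formula σ → Formula σ
  | pred P t => pred P fun i => (t i).sub g
  | eq s t => eq (s.sub g) (t.sub g)
  | bot => bot
  | and φ ψ => and (φ.sub g) (ψ.sub g)
  | or φ ψ => or (φ.sub g) (ψ.sub g)
  | imp φ ψ => imp (φ.sub g) (ψ.sub g)
  | box φ => box (φ.sub g)
  | dia φ => dia (φ.sub g)
  | all y φ => all y (φ.sub (Function.update g y none))
  | ex y φ => ex y (φ.sub (Function.update g y none))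

theorem freeVars_inst (x : ℕ) (c : σ.Const) (φ : Formula σ) :
    (φ.inst x c).freeVars = φ.freeVars.erase x := by
  induction φ with
  | pred P t => ext v; simp [inst, freeVars, Term.vars_inst]
  | eq s t => ext v; simp [inst, freeVars, Term.vars_inst]; tauto
  | bot => rfl
  | and φ ψ h1 h2 | or φ ψ h1 h2 | imp φ ψ h1 h2 =>
    ext v; simp [inst, freeVars, h1, h2]; tauto
  | box φ h | dia φ h => simpa [inst, freeVars] using h
  | all y φ h | ex y φ h =>
    by_cases hy : y = x
    · simp [inst, freeVars, hy]
    · simp [inst, freeVars, hy, h, Finset.erase_right_comm]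

theorem freeVars_abstr (c : σ.Const) (x : ℕ) (φ : Formula σ) :
    (φ.abstr c x).freeVars ⊆ insert x φ.freeVars := by
  induction φ with
  | pred P t =>
    intro v
    simp only [abstr, freeVars, Finset.mem_biUnion, Finset.mem_insert, Finset.mem_univ, true_and]
    rintro ⟨i, hi⟩
    have := Term.vars_abstr c x (t i) hi
    rw [Finset.mem_insert] at this
    exact this.imp_right fun h => ⟨i, h⟩
  | eq s t =>
    have h1 := Term.vars_abstr c x s
    have h2 := Term.vars_abstr c x t
    intro v hv
    simp only [abstr, freeVars, Finset.mem_union, Finset.mem_insert, Finset.subset_iff] at *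
    grind
  | bot => simp [abstr, freeVars]
  | and φ ψ h1 h2 | or φ ψ h1 h2 | imp φ ψ h1 h2 =>
    intro v hv
    simp only [abstr, freeVars, Finset.mem_union, Finset.mem_insert, Finset.subset_iff] at *
    grind
  | box φ h | dia φ h => simpa [abstr, freeVars] using h
  | all y φ h | ex y φ h =>
    intro v hv
    simp only [abstr, freeVars, Finset.mem_erase, Finset.mem_insert, Finset.subset_iff] at *
    grind

theorem HasConst.of_inst {x : ℕ} {c d : σ.Const} {φ : Formula σ} (h : (φ.inst x c).HasConst d) :
    φ.HasConst d ∨ d = c := by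
  induction φ with
  | pred P t =>
    obtain ⟨i, hi⟩ := h
    exact (Term.eq_const_of_inst hi).imp_left fun h => ⟨i, h⟩
  | eq s t =>
    rcases h with h | h
    · exact (Term.eq_const_of_inst h).imp_left .inl
    · exact (Term.eq_const_of_inst h).imp_left .inr
  | bot => exact h.elim
  | and φ ψ h1 h2 | or φ ψ h1 h2 | imp φ ψ h1 h2 =>
    rcases h with h | h
    · exact (h1 h).imp_left .inl
    · exact (h2 h).imp_left .inr
  | box φ ih | dia φ ih => exact ih h
  | all y φ ih | ex y φ ih =>
    by_cases hy : y = x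
    · simp only [inst, hy, if_true] at h
      exact .inl h
    · simp only [inst, hy, if_false] at h
      exact ih h

theorem HasConst.of_abstr {x : ℕ} {c d : σ.Const} {φ : Formula σ}
    (h : (φ.abstr c x).HasConst d) : φ.HasConst d ∧ d ≠ c := by
  induction φ with
  | pred P t =>
    obtain ⟨i, hi⟩ := h
    exact ⟨⟨i, (Term.eq_const_of_abstr hi).1⟩, (Term.eq_const_of_abstr hi).2⟩
  | eq s t =>
    rcases h with h | h
    · exact ⟨.inl (Term.eq_const_of_abstr h).1, (Term.eq_const_of_abstr h).2⟩
    · exact ⟨.inr (Term.eq_const_of_abstr h).1, (Term.eq_const_of_abstr h).2⟩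
  | bot => exact h.elim
  | and φ ψ h1 h2 | or φ ψ h1 h2 | imp φ ψ h1 h2 =>
    rcases h with h | h
    · exact ⟨.inl (h1 h).1, (h1 h).2⟩
    · exact ⟨.inr (h2 h).1, (h2 h).2⟩
  | box φ ih | dia φ ih | all y φ ih | ex y φ ih => exact ih h

theorem abstr_of_not_hasConst {c : σ.Const} (x : ℕ) {φ : Formula σ} (h : ¬φ.HasConst c) :
    φ.abstr c x = φ := by
  induction φ with
  | pred P t =>
    simp only [HasConst, not_exists] at h
    simp [abstr, Term.abstr_of_ne, h]
  | eq s t =>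
    simp only [HasConst, not_or] at h
    simp [abstr, Term.abstr_of_ne, h.1, h.2]
  | bot => rfl
  | and φ ψ h1 h2 | or φ ψ h1 h2 | imp φ ψ h1 h2 =>
    simp only [HasConst, not_or] at h
    simp [abstr, h1 h.1, h2 h.2]
  | box φ ih | dia φ ih | all y φ ih | ex y φ ih => simp [abstr, ih h]

theorem substitutable_of_not_hasConst {c : σ.Const} (x : ℕ) {φ : Formula σ}
    (h : ¬φ.HasConst c) : φ.Substitutable x c := by
  induction φ with
  | pred P t | eq s t | bot => trivial
  | and φ ψ h1 h2 | or φ ψ h1 h2 | imp φ ψ h1 h2 =>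
    simp only [HasConst, not_or] at h
    exact ⟨h1 h.1, h2 h.2⟩
  | box φ ih | dia φ ih => exact ih h
  | all y φ ih | ex y φ ih => exact ⟨fun h' => (h h').elim, ih h⟩

theorem inst_abstr {c : σ.Const} {x : ℕ} {φ : Formula σ} (hx : x ∉ φ.freeVars)
    (h : φ.Substitutable x c) : (φ.abstr c x).inst x c = φ := by
  induction φ with
  | pred P t =>
    simp only [freeVars, Finset.mem_biUnion, Finset.mem_univ, true_and, not_exists] at hx
    simp [abstr, inst, Term.inst_abstr, hx]
  | eq s t =>
    simp only [freeVars, Finset.mem_union, not_or] at hx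
    simp [abstr, inst, Term.inst_abstr, hx.1, hx.2]
  | bot => rfl
  | and φ ψ h1 h2 | or φ ψ h1 h2 | imp φ ψ h1 h2 =>
    simp only [freeVars, Finset.mem_union, not_or] at hx
    simp [abstr, inst, h1 hx.1 h.1, h2 hx.2 h.2]
  | box φ ih | dia φ ih => simp [abstr, inst, ih hx h]
  | all y φ ih | ex y φ ih =>
    by_cases hy : y = x
    · have : ¬φ.HasConst c := fun hc => h.1 hc hy
      simp [abstr, inst, hy, abstr_of_not_hasConst x this]
    · have : x ∉ φ.freeVars := fun hf => hx (Finset.mem_erase.2 ⟨Ne.symm hy, hf⟩)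
      simp [abstr, inst, hy, ih this h.2]

theorem substitutable_inst {c : σ.Const} {x : ℕ} {φ : Formula σ} (h : ¬φ.HasConst c) :
    (φ.inst x c).Substitutable x c := by
  induction φ with
  | pred P t | eq s t | bot => trivial
  | and φ ψ h1 h2 | or φ ψ h1 h2 | imp φ ψ h1 h2 =>
    simp only [HasConst, not_or] at h
    exact ⟨h1 h.1, h2 h.2⟩
  | box φ ih | dia φ ih => exact ih h
  | all y φ ih | ex y φ ih =>
    by_cases hy : y = x
    · simp only [inst, hy, if_true]
      exact substitutable_of_not_hasConst x h
    · simp only [inst, hy, if_false]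
      exact ⟨fun _ => hy, ih h⟩

theorem abstr_inst {c : σ.Const} {x : ℕ} {φ : Formula σ} (h : ¬φ.HasConst c) :
    (φ.inst x c).abstr c x = φ := by
  induction φ with
  | pred P t =>
    simp only [HasConst, not_exists] at h
    simp [abstr, inst, Term.abstr_inst, h]
  | eq s t =>
    simp only [HasConst, not_or] at h
    simp [abstr, inst, Term.abstr_inst, h.1, h.2]
  | bot => rfl
  | and φ ψ h1 h2 | or φ ψ h1 h2 | imp φ ψ h1 h2 =>
    simp only [HasConst, not_or] at h
    simp [abstr, inst, h1 h.1, h2 h.2]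
  | box φ ih | dia φ ih => simp [abstr, inst, ih h]
  | all y φ ih | ex y φ ih =>
    by_cases hy : y = x
    · simp [abstr, inst, hy, abstr_of_not_hasConst x (φ := φ) h]
    · simp [abstr, inst, hy, ih h]

/-- Any variable beyond all the bound ones will do. This supplies the variable with which a constant
is quantified away in `Der.exists_eliminate`. -/
theorem exists_forall_ge_substitutable (c : σ.Const) (φ : Formula σ) :
    ∃ N, ∀ v, N ≤ v → φ.Substitutable v c := by
  induction φ with
  | pred P t | eq s t | bot => exact ⟨0, fun _ _ => trivial⟩
  | and φ ψ h1 h2 | or φ ψ h1 h2 | imp φ ψ h1 h2 =>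
    obtain ⟨N, hN⟩ := h1
    obtain ⟨M, hM⟩ := h2
    exact ⟨max N M, fun v hv => ⟨hN v (by omega), hM v (by omega)⟩⟩
  | box φ ih | dia φ ih => exact ih
  | all y φ ih | ex y φ ih =>
    obtain ⟨N, hN⟩ := ih
    exact ⟨max N (y + 1), fun v hv => ⟨fun _ => by omega, hN v (by omega)⟩⟩

theorem finite_hasConst (φ : Formula σ) : {c | φ.HasConst c}.Finite := by
  induction φ with
  | pred P t =>
    refine Set.Finite.subset (Set.finite_iUnion fun i : Fin (σ.arity P) =>
      (?_ : {c | t i = Term.const c}.Finite)) (fun c hc => ?_)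
    · exact Set.Subsingleton.finite fun a ha b hb => Term.const.inj (ha.symm.trans hb)
    · simpa [HasConst] using hc
  | eq s t =>
    refine Set.Finite.union (s := {c | s = Term.const c}) (t := {c | t = Term.const c}) ?_ ?_ <;>
      exact Set.Subsingleton.finite fun a ha b hb => Term.const.inj (ha.symm.trans hb)
  | bot => simp [HasConst]
  | and φ ψ h1 h2 | or φ ψ h1 h2 | imp φ ψ h1 h2 => exact h1.union h2
  | box φ ih | dia φ ih | all y φ ih | ex y φ ih => exact ih

/-- Under a quantifier `sub` masks the bound variable with `none`, so that variable is still
available for instantiation. This drives the quantifier cases of the truth lemma. -/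
theorem inst_sub (x : ℕ) (a : σ.Const) (g : ℕ → Option σ.Const) (φ : Formula σ) :
    (φ.sub (Function.update g x none)).inst x a = φ.sub (Function.update g x (some a)) := by
  induction φ generalizing g with
  | pred P t => simp [sub, inst, Term.inst_sub]
  | eq s t => simp [sub, inst, Term.inst_sub]
  | bot => rfl
  | and φ ψ h1 h2 | or φ ψ h1 h2 | imp φ ψ h1 h2 => simp [sub, inst, h1, h2]
  | box φ ih | dia φ ih => simp [sub, inst, ih]
  | all y φ ih | ex y φ ih =>
    by_cases hy : y = x
    · simp [sub, inst, hy]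
    · simp only [sub, inst, hy, if_false]
      rw [Function.update_comm (Ne.symm hy), ih, Function.update_comm (Ne.symm hy)]

theorem mem_freeVars_sub {g : ℕ → Option σ.Const} {φ : Formula σ} {v : ℕ}
    (h : v ∈ (φ.sub g).freeVars) : v ∈ φ.freeVars ∧ g v = none := by
  induction φ generalizing g with
  | pred P t =>
    simp only [sub, freeVars, Finset.mem_biUnion, Finset.mem_univ, true_and] at h ⊢
    obtain ⟨i, hi⟩ := h
    exact ⟨⟨i, (Term.mem_vars_sub hi).1⟩, (Term.mem_vars_sub hi).2⟩
  | eq s t =>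
    simp only [sub, freeVars, Finset.mem_union] at h ⊢
    rcases h with h | h
    · exact ⟨.inl (Term.mem_vars_sub h).1, (Term.mem_vars_sub h).2⟩
    · exact ⟨.inr (Term.mem_vars_sub h).1, (Term.mem_vars_sub h).2⟩
  | bot => simp [sub, freeVars] at h
  | and φ ψ h1 h2 | or φ ψ h1 h2 | imp φ ψ h1 h2 =>
    simp only [sub, freeVars, Finset.mem_union] at h ⊢
    rcases h with h | h
    · exact ⟨.inl (h1 h).1, (h1 h).2⟩
    · exact ⟨.inr (h2 h).1, (h2 h).2⟩
  | box φ ih | dia φ ih => exact ih h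
  | all y φ ih | ex y φ ih =>
    simp only [sub, freeVars, Finset.mem_erase] at h ⊢
    have := ih h.2
    rw [Function.update_of_ne h.1] at this
    exact ⟨⟨h.1, this.1⟩, this.2⟩

theorem HasConst.of_sub {g : ℕ → Option σ.Const} {φ : Formula σ} {c : σ.Const}
    (h : (φ.sub g).HasConst c) : φ.HasConst c ∨ ∃ v, g v = some c := by
  induction φ generalizing g with
  | pred P t =>
    obtain ⟨i, hi⟩ := h
    exact (Term.eq_const_of_sub hi).imp_left fun h => ⟨i, h⟩
  | eq s t =>
    rcases h with h | h
    · exact (Term.eq_const_of_sub h).imp_left .inl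
    · exact (Term.eq_const_of_sub h).imp_left .inr
  | bot => exact h.elim
  | and φ ψ h1 h2 | or φ ψ h1 h2 | imp φ ψ h1 h2 =>
    rcases h with h | h
    · exact (h1 h).imp_left .inl
    · exact (h2 h).imp_left .inr
  | box φ ih | dia φ ih => exact ih h
  | all y φ ih | ex y φ ih =>
    refine (ih h).imp_right ?_
    rintro ⟨v, hv⟩
    by_cases hvy : v = y
    · simp [hvy] at hv
    · exact ⟨v, by rwa [Function.update_of_ne hvy] at hv⟩

theorem sub_eq_self {g : ℕ → Option σ.Const} {φ : Formula σ}
    (h : ∀ v ∈ φ.freeVars, g v = none) : φ.sub g = φ := by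
  induction φ generalizing g with
  | pred P t =>
    simp only [freeVars, Finset.mem_biUnion, Finset.mem_univ, true_and] at h
    simp only [sub]
    congr 1
    ext i
    exact Term.sub_eq_self fun v hv => h v ⟨i, hv⟩
  | eq s t =>
    simp only [freeVars, Finset.mem_union] at h
    simp only [sub]
    rw [Term.sub_eq_self fun v hv => h v (.inl hv), Term.sub_eq_self fun v hv => h v (.inr hv)]
  | bot => rfl
  | and φ ψ h1 h2 | or φ ψ h1 h2 | imp φ ψ h1 h2 =>
    simp only [freeVars, Finset.mem_union] at h
    simp only [sub]
    rw [h1 fun v hv => h v (.inl hv), h2 fun v hv => h v (.inr hv)]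
  | box φ ih | dia φ ih => simp only [sub]; rw [ih h]
  | all y φ ih | ex y φ ih =>
    simp only [sub]
    rw [ih]
    intro v hv
    by_cases hvy : v = y
    · simp [hvy]
    · rw [Function.update_of_ne hvy]
      exact h v (Finset.mem_erase.2 ⟨hvy, hv⟩)

theorem freeVars_rename (f : σ.Const → σ.Const) (φ : Formula σ) :
    (φ.rename f).freeVars = φ.freeVars := by
  induction φ <;> simp_all [rename, freeVars, Term.vars_rename]

theorem IsSentence.rename {φ : Formula σ} (h : φ.IsSentence) (f : σ.Const → σ.Const) :
    (φ.rename f).IsSentence := by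
  rwa [IsSentence, freeVars_rename]

theorem hasConst_rename {f : σ.Const → σ.Const} {φ : Formula σ} {c : σ.Const} :
    (φ.rename f).HasConst c ↔ ∃ d, φ.HasConst d ∧ f d = c := by
  induction φ with
  | pred P t => simp only [rename, HasConst, Term.rename_eq_const]; grind
  | eq s t => simp only [rename, HasConst, Term.rename_eq_const]; grind
  | bot => simp [rename, HasConst]
  | and φ ψ h1 h2 | or φ ψ h1 h2 | imp φ ψ h1 h2 => simp only [rename, HasConst, h1, h2]; grind
  | box φ ih | dia φ ih | all y φ ih | ex y φ ih => simpa [rename, HasConst] using ih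

theorem rename_inst (f : σ.Const → σ.Const) (x : ℕ) (c : σ.Const) (φ : Formula σ) :
    (φ.inst x c).rename f = (φ.rename f).inst x (f c) := by
  induction φ with
  | all y φ ih | ex y φ ih => by_cases hy : y = x <;> simp [rename, inst, hy, ih]
  | _ => simp_all [rename, inst, Term.rename_inst]

theorem rename_abstr {f : σ.Const → σ.Const} (hf : Function.Injective f) (c : σ.Const) (x : ℕ)
    (φ : Formula σ) : (φ.abstr c x).rename f = (φ.rename f).abstr (f c) x := by
  induction φ <;> simp_all [rename, abstr, Term.rename_abstr hf]

theorem Substitutable.rename {f : σ.Const → σ.Const} (hf : Function.Injective f) {c : σ.Const}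
    {x : ℕ} {φ : Formula σ} (h : φ.Substitutable x c) : (φ.rename f).Substitutable x (f c) := by
  induction φ with
  | pred P t | eq s t | bot => trivial
  | and φ ψ h1 h2 | or φ ψ h1 h2 | imp φ ψ h1 h2 => exact ⟨h1 h.1, h2 h.2⟩
  | box φ ih | dia φ ih => exact ih h
  | all y φ ih | ex y φ ih =>
    refine ⟨fun hc => ?_, ih h.2⟩
    obtain ⟨d, hd, hdc⟩ := hasConst_rename.1 hc
    exact h.1 (hf hdc ▸ hd)

theorem ModalFree.rename {f : σ.Const → σ.Const} {φ : Formula σ} (h : φ.ModalFree) :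
    (φ.rename f).ModalFree := by
  induction φ <;> simp_all [Formula.rename, ModalFree]

theorem rename_rename (f g : σ.Const → σ.Const) (φ : Formula σ) :
    (φ.rename g).rename f = φ.rename (f ∘ g) := by
  induction φ <;> simp_all [rename, Term.rename_rename]

theorem rename_eq_self {f : σ.Const → σ.Const} {φ : Formula σ}
    (h : ∀ c, φ.HasConst c → f c = c) : φ.rename f = φ := by
  induction φ with
  | pred P t =>
    simp only [rename]
    congr 1
    ext i
    exact Term.rename_eq_self fun c hc => h c ⟨i, hc⟩
  | eq s t =>
    simp only [rename]
    rw [Term.rename_eq_self fun c hc => h c (.inl hc), Term.rename_eq_self fun c hc => h c (.inr hc)]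
  | bot => rfl
  | and φ ψ h1 h2 | or φ ψ h1 h2 | imp φ ψ h1 h2 =>
    simp only [rename]
    rw [h1 fun c hc => h c (.inl hc), h2 fun c hc => h c (.inr hc)]
  | box φ ih | dia φ ih | all y φ ih | ex y φ ih => simp only [rename]; rw [ih h]

theorem rename_bigAnd (f : σ.Const → σ.Const) (l : List (Formula σ)) :
    (bigAnd l).rename f = bigAnd (l.map (rename f)) := by
  induction l <;> simp_all [bigAnd, rename, top, neg]

/-! ### Countability of the set of formulas -/

/-- The nesting depth of the connectives of a formula. -/
def depth : Formula σ → ℕ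
  | pred _ _ => 0
  | eq _ _ => 0
  | bot => 0
  | and φ ψ => max φ.depth ψ.depth + 1
  | or φ ψ => max φ.depth ψ.depth + 1
  | imp φ ψ => max φ.depth ψ.depth + 1
  | box φ => φ.depth + 1
  | dia φ => φ.depth + 1
  | all _ φ => φ.depth + 1
  | ex _ φ => φ.depth + 1

theorem countable_depth_lt (n : ℕ) : {φ : Formula σ | φ.depth < n}.Countable := by
  induction n with
  | zero => simp
  | succ n ih =>
    set S := {φ : Formula σ | φ.depth < n}
    have hP : (⋃ P : σ.Pred, Set.range (pred P)).Countable :=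
      Set.countable_iUnion fun P => Set.countable_range _
    have hE : (Set.range fun p : Term σ × Term σ => eq p.1 p.2).Countable := Set.countable_range _
    have hA : (⋃ x : ℕ, all x '' S ∪ ex x '' S).Countable :=
      Set.countable_iUnion fun x => (ih.image _).union (ih.image _)
    refine Set.Countable.mono ?_ (hP.union <| hE.union <| (Set.countable_singleton bot).union <|
      (ih.image2 ih and).union <| (ih.image2 ih or).union <| (ih.image2 ih imp).union <|
      (ih.image box).union <| (ih.image dia).union hA)
    intro φ hφ
    simp only [Set.mem_union, Set.mem_iUnion]
    cases φ with
    | pred P t => exact .inl ⟨P, t, rfl⟩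
    | eq s t => exact .inr (.inl ⟨(s, t), rfl⟩)
    | bot => exact .inr (.inr (.inl rfl))
    | and φ ψ =>
      have : φ.depth < n ∧ ψ.depth < n := by simpa [depth] using hφ
      exact .inr (.inr (.inr (.inl ⟨φ, this.1, ψ, this.2, rfl⟩)))
    | or φ ψ =>
      have : φ.depth < n ∧ ψ.depth < n := by simpa [depth] using hφ
      exact .inr (.inr (.inr (.inr (.inl ⟨φ, this.1, ψ, this.2, rfl⟩))))
    | imp φ ψ =>
      have : φ.depth < n ∧ ψ.depth < n := by simpa [depth] using hφ
      exact .inr (.inr (.inr (.inr (.inr (.inl ⟨φ, this.1, ψ, this.2, rfl⟩)))))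
    | box φ =>
      have : φ.depth < n := by simpa [depth] using hφ
      exact .inr (.inr (.inr (.inr (.inr (.inr (.inl ⟨φ, this, rfl⟩))))))
    | dia φ =>
      have : φ.depth < n := by simpa [depth] using hφ
      exact .inr (.inr (.inr (.inr (.inr (.inr (.inr (.inl ⟨φ, this, rfl⟩)))))))
    | all x φ =>
      have : φ.depth < n := by simpa [depth] using hφ
      exact .inr (.inr (.inr (.inr (.inr (.inr (.inr (.inr ⟨x, .inl ⟨φ, this, rfl⟩⟩)))))))
    | ex x φ =>
      have : φ.depth < n := by simpa [depth] using hφ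
      exact .inr (.inr (.inr (.inr (.inr (.inr (.inr (.inr ⟨x, .inr ⟨φ, this, rfl⟩⟩)))))))

instance : Countable (Formula σ) := by
  rw [← Set.countable_univ_iff]
  refine (Set.countable_iUnion countable_depth_lt).mono fun φ _ => ?_
  exact Set.mem_iUnion.2 ⟨φ.depth + 1, Nat.lt_succ_self _⟩

end Formula

end FOFS

namespace FOFS

open Formula

variable {σ : Signature.{u}}

/-! ### Sentences and renaming of theorems -/

/-- The sentences all of whose constants lie in `D`. -/
def Sent (D : Set σ.Const) : Set (Formula σ) := {φ | φ.IsSentence ∧ ∀ c, φ.HasConst c → c ∈ D}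

theorem Sent.mono {D E : Set σ.Const} (h : D ⊆ E) : (Sent D : Set (Formula σ)) ⊆ Sent E :=
  fun _ hφ => ⟨hφ.1, fun c hc => h (hφ.2 c hc)⟩

section

variable {D : Set σ.Const} {φ ψ : Formula σ} {x : ℕ}

theorem isSentence_bot : (bot : Formula σ).IsSentence := rfl

theorem isSentence_top : (top : Formula σ).IsSentence := rfl

theorem isSentence_and : (and φ ψ).IsSentence ↔ φ.IsSentence ∧ ψ.IsSentence :=
  Finset.union_eq_empty

theorem isSentence_or : (or φ ψ).IsSentence ↔ φ.IsSentence ∧ ψ.IsSentence :=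
  Finset.union_eq_empty

theorem isSentence_imp : (imp φ ψ).IsSentence ↔ φ.IsSentence ∧ ψ.IsSentence :=
  Finset.union_eq_empty

theorem isSentence_box : (box φ).IsSentence ↔ φ.IsSentence := Iff.rfl

theorem isSentence_dia : (dia φ).IsSentence ↔ φ.IsSentence := Iff.rfl

theorem isSentence_all : (all x φ).IsSentence ↔ φ.freeVars ⊆ {x} := by
  simp only [IsSentence, freeVars, Finset.erase_eq_empty_iff, Finset.subset_singleton_iff]

theorem isSentence_ex : (ex x φ).IsSentence ↔ φ.freeVars ⊆ {x} := isSentence_all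

theorem isSentence_inst {c : σ.Const} : (φ.inst x c).IsSentence ↔ φ.freeVars ⊆ {x} := by
  rw [IsSentence, freeVars_inst]
  exact isSentence_all

theorem freeVars_abstr_of_isSentence (h : φ.IsSentence) (c : σ.Const) :
    (φ.abstr c x).freeVars ⊆ {x} := by
  have := freeVars_abstr c x φ
  rwa [show φ.freeVars = ∅ from h] at this

theorem isSentence_eq_const (a b : σ.Const) :
    (Formula.eq (.const a) (.const b)).IsSentence := rfl

theorem bot_mem_sent : (bot : Formula σ) ∈ Sent D := ⟨rfl, fun _ h => h.elim⟩

theorem top_mem_sent : (top : Formula σ) ∈ Sent D := ⟨rfl, fun _ h => h.elim False.elim False.elim⟩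

theorem and_mem_sent : and φ ψ ∈ Sent D ↔ φ ∈ Sent D ∧ ψ ∈ Sent D := by
  simp only [Sent, Set.mem_ofPred_eq, isSentence_and, HasConst]
  grind

theorem or_mem_sent : or φ ψ ∈ Sent D ↔ φ ∈ Sent D ∧ ψ ∈ Sent D := by
  simp only [Sent, Set.mem_ofPred_eq, isSentence_or, HasConst]
  grind

theorem imp_mem_sent : imp φ ψ ∈ Sent D ↔ φ ∈ Sent D ∧ ψ ∈ Sent D := by
  simp only [Sent, Set.mem_ofPred_eq, isSentence_imp, HasConst]
  grind

theorem box_mem_sent : box φ ∈ Sent D ↔ φ ∈ Sent D := Iff.rfl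

theorem dia_mem_sent : dia φ ∈ Sent D ↔ φ ∈ Sent D := Iff.rfl

theorem inst_mem_sent {c : σ.Const} (hx : φ.freeVars ⊆ {x}) (hφ : ∀ d, φ.HasConst d → d ∈ D)
    (hc : c ∈ D) : φ.inst x c ∈ Sent D :=
  ⟨isSentence_inst.2 hx, fun d hd => hd.of_inst.elim (hφ d) fun e => e ▸ hc⟩

theorem eq_mem_sent {a b : σ.Const} :
    Formula.eq (.const a) (.const b) ∈ Sent D ↔ a ∈ D ∧ b ∈ D := by
  simp only [Sent, Set.mem_ofPred_eq, isSentence_eq_const, HasConst, Term.const.injEq]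
  grind

end

theorem isSentence_subst {s : ℕ → Formula σ} (hs : ∀ n, (s n).IsSentence) (A : PropForm) :
    (A.subst s).IsSentence := by
  induction A with
  | atom n => exact hs n
  | bot => rfl
  | and A B h1 h2 => exact isSentence_and.2 ⟨h1, h2⟩
  | or A B h1 h2 => exact isSentence_or.2 ⟨h1, h2⟩
  | imp A B h1 h2 => exact isSentence_imp.2 ⟨h1, h2⟩

theorem isSentence_of_mem_S4Axioms {φ : Formula σ} (h : φ ∈ S4Axioms σ) : φ.IsSentence := by
  obtain ⟨φ, hφ, rfl | rfl | rfl | rfl⟩ := h <;>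
    simpa [isSentence_imp, isSentence_box, isSentence_dia] using hφ

theorem Provable.isSentence {Ax : Set (Formula σ)} (hAx : ∀ φ ∈ Ax, φ.IsSentence)
    {φ : Formula σ} (h : Provable Ax φ) : φ.IsSentence := by
  induction h with
  | ax h => exact hAx _ h
  | int A s _ hs => exact isSentence_subst hs A
  | box_and φ ψ h1 h2 | dia_or φ ψ h1 h2 | fs1 φ ψ h1 h2 | fs2 φ ψ h1 h2 =>
    simp [iff, isSentence_and, isSentence_or, isSentence_imp, isSentence_box, isSentence_dia, h1,
      h2]
  | box_top | dia_bot | id_refl => rfl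
  | univ x c φ h | exist x c φ h =>
    simp [isSentence_imp, isSentence_all, isSentence_ex, isSentence_inst, h]
  | all_ant x φ ψ h1 h2 =>
    exact isSentence_imp.2 ⟨isSentence_all.2 (Finset.union_subset h1 (by simp [show _ = _ from h2])),
      isSentence_imp.2 ⟨isSentence_ex.2 h1, h2⟩⟩
  | all_con x φ ψ h1 h2 =>
    exact isSentence_imp.2 ⟨isSentence_all.2 (Finset.union_subset (by simp [show _ = _ from h1]) h2),
      isSentence_imp.2 ⟨h1, isSentence_all.2 h2⟩⟩
  | id_sub c₁ c₂ x φ h _ => simp [isSentence_imp, isSentence_inst, h, isSentence_eq_const]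
  | mp _ _ h _ => exact (isSentence_imp.1 h).2
  | gen c x _ _ h => exact isSentence_all.2 (freeVars_abstr_of_isSentence h c)
  | reg_box _ h | reg_dia _ h => exact h

theorem rename_subst (f : σ.Const → σ.Const) (s : ℕ → Formula σ) (A : PropForm) :
    (A.subst s).rename f = A.subst fun n => (s n).rename f := by
  induction A <;> simp_all [PropForm.subst, rename]

theorem rename_mem_S4Axioms (f : σ.Const → σ.Const) {φ : Formula σ} (h : φ ∈ S4Axioms σ) :
    φ.rename f ∈ S4Axioms σ := by
  obtain ⟨φ, hφ, rfl | rfl | rfl | rfl⟩ := h <;> refine ⟨φ.rename f, hφ.rename f, ?_⟩ <;>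
    simp [rename]

/-- Injectivity matters only for generalization: if two constants were identified, abstracting one
would capture occurrences of the other. -/
theorem Provable.rename {Ax : Set (Formula σ)} {f : σ.Const → σ.Const}
    (hAx : ∀ φ ∈ Ax, φ.rename f ∈ Ax) (hf : Function.Injective f) {φ : Formula σ}
    (h : Provable Ax φ) : Provable Ax (φ.rename f) := by
  induction h with
  | ax h => exact .ax (hAx _ h)
  | int A s hA hs =>
    rw [rename_subst]
    exact .int A _ hA fun n => (hs n).rename f
  | box_and φ ψ h1 h2 => exact .box_and _ _ (h1.rename f) (h2.rename f)
  | box_top => exact .box_top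
  | dia_or φ ψ h1 h2 => exact .dia_or _ _ (h1.rename f) (h2.rename f)
  | dia_bot => exact .dia_bot
  | fs1 φ ψ h1 h2 => exact .fs1 _ _ (h1.rename f) (h2.rename f)
  | fs2 φ ψ h1 h2 => exact .fs2 _ _ (h1.rename f) (h2.rename f)
  | univ x c φ h =>
    simp only [Formula.rename, rename_inst]
    exact .univ _ _ _ (by rwa [freeVars_rename])
  | exist x c φ h =>
    simp only [Formula.rename, rename_inst]
    exact .exist _ _ _ (by rwa [freeVars_rename])
  | all_ant x φ ψ h1 h2 => exact .all_ant _ _ _ (by rwa [freeVars_rename]) (h2.rename f)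
  | all_con x φ ψ h1 h2 => exact .all_con _ _ _ (h1.rename f) (by rwa [freeVars_rename])
  | id_refl c => exact .id_refl _
  | id_sub c₁ c₂ x φ h h' =>
    simp only [Formula.rename, rename_inst]
    exact .id_sub _ _ _ _ (by rwa [freeVars_rename]) h'.rename
  | mp _ _ h1 h2 => exact .mp h1 h2
  | gen c x h _ ih =>
    simp only [Formula.rename, rename_abstr hf]
    exact .gen _ _ (h.rename hf) ih
  | reg_box _ h => exact .reg_box h
  | reg_dia _ h => exact .reg_dia h

/-! ### Derivations from hypotheses -/

/-- Derivability in `FOFS-S4` from hypotheses by modus ponens. -/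
inductive Der (X : Set (Formula σ)) : Formula σ → Prop
  | hyp {φ} : φ ∈ X → φ.IsSentence → Der X φ
  | thm {φ} : Provable (S4Axioms σ) φ → Der X φ
  | mp {φ ψ} : Der X (imp φ ψ) → Der X φ → Der X ψ

section IPC

variable {φ ψ χ : Formula σ}

/-- The substitution of three formulas for the first three atoms. -/
def subst₃ (φ ψ χ : Formula σ) : ℕ → Formula σ
  | 0 => φ
  | 1 => ψ
  | 2 => χ
  | _ => bot

theorem isSentence_subst₃ (h1 : φ.IsSentence) (h2 : ψ.IsSentence) (h3 : χ.IsSentence) (n : ℕ) :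
    (subst₃ φ ψ χ n).IsSentence := by
  match n with
  | 0 => exact h1
  | 1 => exact h2
  | 2 => exact h3
  | _ + 3 => rfl

theorem provable_subst₃ {A : PropForm} (hA : IPC A) (h1 : φ.IsSentence) (h2 : ψ.IsSentence)
    (h3 : χ.IsSentence) : Provable (S4Axioms σ) (A.subst (subst₃ φ ψ χ)) :=
  .int A _ hA (isSentence_subst₃ h1 h2 h3)

theorem provable_k (h1 : φ.IsSentence) (h2 : ψ.IsSentence) :
    Provable (S4Axioms σ) (imp φ (imp ψ φ)) :=
  provable_subst₃ (IPC.k (.atom 0) (.atom 1)) h1 h2 h2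

theorem provable_s (h1 : φ.IsSentence) (h2 : ψ.IsSentence) (h3 : χ.IsSentence) :
    Provable (S4Axioms σ) (imp (imp φ (imp ψ χ)) (imp (imp φ ψ) (imp φ χ))) :=
  provable_subst₃ (IPC.s (.atom 0) (.atom 1) (.atom 2)) h1 h2 h3

theorem provable_id (h : φ.IsSentence) : Provable (S4Axioms σ) (imp φ φ) :=
  .mp (.mp (provable_s h (isSentence_imp.2 ⟨h, h⟩) h) (provable_k h (isSentence_imp.2 ⟨h, h⟩)))
    (provable_k h h)

end IPC

namespace Der

variable {X Y : Set (Formula σ)} {φ ψ χ : Formula σ} {x : ℕ} {c : σ.Const}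

theorem isSentence (h : Der X φ) : φ.IsSentence := by
  induction h with
  | hyp _ h => exact h
  | thm h => exact h.isSentence fun _ => isSentence_of_mem_S4Axioms
  | mp _ _ h _ => exact (isSentence_imp.1 h).2

theorem cut (h : Der X φ) (hX : ∀ ψ ∈ X, ψ.IsSentence → Der Y ψ) : Der Y φ := by
  induction h with
  | hyp h1 h2 => exact hX _ h1 h2
  | thm h => exact .thm h
  | mp _ _ h1 h2 => exact .mp h1 h2

theorem mono (h : Der X φ) (hX : X ⊆ Y) : Der Y φ := h.cut fun _ h1 h2 => .hyp (hX h1) h2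

theorem head (h : φ.IsSentence) : Der (insert φ X) φ := .hyp (Set.mem_insert _ _) h

theorem self (h : φ.IsSentence) : Der {φ} φ := .hyp rfl h

/-- The deduction theorem needs only the axioms K and S, because `Der` applies generalization and
the modal rules to theorems alone. -/
theorem imp_intro (hφ : φ.IsSentence) (h : Der (insert φ X) ψ) : Der X (imp φ ψ) := by
  induction h with
  | hyp h1 h2 =>
    rcases h1 with rfl | h1
    · exact .thm (provable_id hφ)
    · exact .mp (.thm (provable_k h2 hφ)) (.hyp h1 h2)
  | thm h =>
    exact .mp (.thm (provable_k (h.isSentence fun _ => isSentence_of_mem_S4Axioms) hφ)) (.thm h)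
  | mp h1 h2 ih1 ih2 =>
    exact .mp (.mp (.thm (provable_s hφ h2.isSentence (isSentence_imp.1 h1.isSentence).2)) ih1) ih2

theorem trans (h1 : Der X φ) (h2 : Der {φ} ψ) : Der X ψ :=
  h2.cut fun _ h _ => Set.mem_singleton_iff.1 h ▸ h1

theorem provable (h : Der ∅ φ) : Provable (S4Axioms σ) φ := by
  induction h with
  | hyp h _ => exact h.elim
  | thm h => exact h
  | mp _ _ h1 h2 => exact .mp h1 h2

theorem provable_imp (hφ : φ.IsSentence) (h : Der {φ} ψ) : Provable (S4Axioms σ) (imp φ ψ) :=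
  (imp_intro hφ (by simpa using h)).provable

theorem apply_imp (h : Provable (S4Axioms σ) (imp φ ψ)) (h' : Der X φ) : Der X ψ :=
  .mp (.thm h) h'

theorem and_intro (h1 : Der X φ) (h2 : Der X ψ) : Der X (and φ ψ) :=
  .mp (.mp (.thm (provable_subst₃ (IPC.and_intro (.atom 0) (.atom 1)) h1.isSentence h2.isSentence
    h2.isSentence)) h1) h2

theorem and_left (h : Der X (and φ ψ)) : Der X φ :=
  have hs := isSentence_and.1 h.isSentence
  .mp (.thm (provable_subst₃ (IPC.and_left (.atom 0) (.atom 1)) hs.1 hs.2 hs.2)) h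

theorem and_right (h : Der X (and φ ψ)) : Der X ψ :=
  have hs := isSentence_and.1 h.isSentence
  .mp (.thm (provable_subst₃ (IPC.and_right (.atom 0) (.atom 1)) hs.1 hs.2 hs.2)) h

theorem or_left (h : Der X φ) (hψ : ψ.IsSentence) : Der X (or φ ψ) :=
  .mp (.thm (provable_subst₃ (IPC.or_left (.atom 0) (.atom 1)) h.isSentence hψ hψ)) h

theorem or_right (hφ : φ.IsSentence) (h : Der X ψ) : Der X (or φ ψ) :=
  .mp (.thm (provable_subst₃ (IPC.or_right (.atom 0) (.atom 1)) hφ h.isSentence hφ)) h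

theorem or_elim (h : Der X (or φ ψ)) (h1 : Der (insert φ X) χ) (h2 : Der (insert ψ X) χ) :
    Der X χ :=
  have hs := isSentence_or.1 h.isSentence
  .mp (.mp (.mp (.thm (provable_subst₃ (IPC.or_elim (.atom 0) (.atom 1) (.atom 2)) hs.1 hs.2
    h1.isSentence)) (imp_intro hs.1 h1)) (imp_intro hs.2 h2)) h

theorem ex_falso (h : Der X bot) (hφ : φ.IsSentence) : Der X φ :=
  .mp (.thm (provable_subst₃ (IPC.ex_falso (.atom 0)) hφ hφ hφ)) h

theorem top_intro : Der X top := imp_intro isSentence_bot (head isSentence_bot)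

/-- Compactness over a downward directed set of hypotheses. -/
theorem exists_of_directed {A : Set (Formula σ)} (hA : A.Nonempty)
    (hd : ∀ a ∈ A, ∀ b ∈ A, ∃ c ∈ A, Der {c} a ∧ Der {c} b) (h : Der (X ∪ A) φ) :
    ∃ a ∈ A, Der (insert a X) φ := by
  induction h with
  | hyp h1 h2 =>
    rcases h1 with h1 | h1
    · obtain ⟨a, ha⟩ := hA
      exact ⟨a, ha, .hyp (.inr h1) h2⟩
    · exact ⟨_, h1, head h2⟩
  | thm h =>
    obtain ⟨a, ha⟩ := hA
    exact ⟨a, ha, .thm h⟩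
  | mp _ _ ih1 ih2 =>
    obtain ⟨a, ha, h1⟩ := ih1
    obtain ⟨b, hb, h2⟩ := ih2
    obtain ⟨c, hc, hca, hcb⟩ := hd a ha b hb
    have key : ∀ {d θ}, Der {c} d → Der (insert d X) θ → Der (insert c X) θ := fun hd hθ =>
      hθ.cut fun _ h h' => h.elim (fun e => e ▸ hd.mono (by simp)) fun h => .hyp (.inr h) h'
    exact ⟨c, hc, .mp (key hca h1) (key hcb h2)⟩

theorem of_mem_bigAnd {l : List (Formula σ)} (h : φ ∈ l) (hl : Der X (bigAnd l)) : Der X φ := by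
  induction l with
  | nil => simp at h
  | cons ψ l ih =>
    rcases List.mem_cons.1 h with rfl | h
    · exact hl.and_left
    · exact ih h hl.and_right

theorem isSentence_bigAnd {l : List (Formula σ)} :
    (bigAnd l).IsSentence ↔ ∀ φ ∈ l, φ.IsSentence := by
  induction l with
  | nil => simp [bigAnd, isSentence_top]
  | cons ψ l ih => simp [bigAnd, isSentence_and, ih]

theorem exists_bigAnd (h : Der X φ) :
    ∃ l : List (Formula σ), (∀ γ ∈ l, γ ∈ X ∧ γ.IsSentence) ∧ Der {bigAnd l} φ := by
  induction h with
  | @hyp φ h1 h2 =>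
    refine ⟨[φ], by simp [h1, h2], of_mem_bigAnd (l := [φ]) (by simp) (self ?_)⟩
    simpa [isSentence_bigAnd] using h2
  | thm h => exact ⟨[], by simp, .thm h⟩
  | mp _ _ ih1 ih2 =>
    obtain ⟨l, hl, h1⟩ := ih1
    obtain ⟨m, hm, h2⟩ := ih2
    have hlm : ∀ γ ∈ l ++ m, γ ∈ X ∧ γ.IsSentence := by
      intro γ hγ
      rcases List.mem_append.1 hγ with h | h
      exacts [hl γ h, hm γ h]
    have hs : (bigAnd (l ++ m)).IsSentence := isSentence_bigAnd.2 fun γ hγ => (hlm γ hγ).2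
    have key : ∀ k : List (Formula σ), (∀ γ ∈ k, γ ∈ l ++ m) →
        Der {bigAnd (l ++ m)} (bigAnd k) := by
      intro k hk
      induction k with
      | nil => exact top_intro
      | cons a k ih =>
        exact and_intro (of_mem_bigAnd (hk a (by simp)) (self hs))
          (ih fun γ hγ => hk γ (by simp [hγ]))
    exact ⟨l ++ m, hlm, .mp ((key l fun γ hγ => by simp [hγ]).trans h1)
      ((key m fun γ hγ => by simp [hγ]).trans h2)⟩

/-! ### Modal rules -/

theorem box_mono (hφ : φ.IsSentence) (h : Der {φ} ψ) (h' : Der X (box φ)) : Der X (box ψ) :=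
  apply_imp (.reg_box (provable_imp hφ h)) h'

theorem dia_mono (hφ : φ.IsSentence) (h : Der {φ} ψ) (h' : Der X (dia φ)) : Der X (dia ψ) :=
  apply_imp (.reg_dia (provable_imp hφ h)) h'

theorem box_and_intro (h1 : Der X (box φ)) (h2 : Der X (box ψ)) : Der X (box (and φ ψ)) :=
  .mp (and_right (.thm (.box_and φ ψ h1.isSentence h2.isSentence))) (and_intro h1 h2)

theorem box_top : Der X (box top) := .thm .box_top

theorem not_dia_bot (h : Der X (dia bot)) : Der X bot := apply_imp .dia_bot h

theorem box_imp_intro (h : Der X (imp (dia φ) (box ψ))) : Der X (box (imp φ ψ)) :=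
  have hs := isSentence_imp.1 h.isSentence
  apply_imp (.fs1 φ ψ hs.1 hs.2) h

theorem dia_imp_elim (h : Der X (dia (imp φ ψ))) (h' : Der X (box φ)) : Der X (dia ψ) :=
  have hs := isSentence_imp.1 (isSentence_dia.1 h.isSentence)
  .mp (apply_imp (.fs2 φ ψ hs.1 hs.2) h) h'

theorem box_elim (h : Der X (box φ)) : Der X φ :=
  apply_imp (.ax ⟨φ, h.isSentence, .inl rfl⟩) h

theorem dia_intro (h : Der X φ) : Der X (dia φ) :=
  apply_imp (.ax ⟨φ, h.isSentence, .inr (.inl rfl)⟩) h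

theorem box_box (h : Der X (box φ)) : Der X (box (box φ)) :=
  apply_imp (.ax ⟨φ, h.isSentence, .inr (.inr (.inl rfl))⟩) h

theorem dia_dia (h : Der X (dia (dia φ))) : Der X (dia φ) :=
  apply_imp (.ax ⟨φ, h.isSentence, .inr (.inr (.inr rfl))⟩) h

/-! ### Quantifier and identity rules -/

theorem all_elim (h : Der X (all x φ)) (c : σ.Const) : Der X (φ.inst x c) :=
  apply_imp (.univ x c φ (isSentence_all.1 h.isSentence)) h

theorem ex_intro (h : Der X (φ.inst x c)) : Der X (ex x φ) :=
  apply_imp (.exist x c φ (isSentence_inst.1 h.isSentence)) h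

theorem all_intro (hX : ∀ γ ∈ X, ¬γ.HasConst c) (hφ : ¬φ.HasConst c)
    (h : Der X (φ.inst x c)) : Der X (all x φ) := by
  obtain ⟨l, hl, h'⟩ := h.exists_bigAnd
  have hs : (bigAnd l).IsSentence := isSentence_bigAnd.2 fun γ hγ => (hl γ hγ).2
  have hc : ¬(bigAnd l).HasConst c := by
    have : ∀ γ ∈ l, ¬γ.HasConst c := fun γ hγ => hX γ (hl γ hγ).1
    clear h' hl hs
    induction l with
    | nil => simp [bigAnd, top, neg, HasConst]
    | cons a l ih =>
      rintro (h | h)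
      · exact this a (by simp) h
      · exact ih (fun γ hγ => this γ (by simp [hγ])) h
  -- Generalization applies to theorems only, so the finitely many hypotheses used are first moved
  -- into an antecedent. That antecedent does not contain `c`, and the quantifier can then be pushed
  -- past it.
  have h1 := Provable.gen c x
    (show Substitutable x c (imp (bigAnd l) (φ.inst x c)) from
      ⟨substitutable_of_not_hasConst x hc, substitutable_inst hφ⟩) (provable_imp hs h')
  rw [abstr, abstr_inst hφ, abstr_of_not_hasConst x hc] at h1
  have hφx := isSentence_inst.1 h.isSentence
  have hl' : Der X (bigAnd l) := by
    clear h' h1 hc hs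
    induction l with
    | nil => exact top_intro
    | cons a l ih =>
      exact and_intro (.hyp (hl a (by simp)).1 (hl a (by simp)).2)
        (ih fun γ hγ => hl γ (by simp [hγ]))
  exact .mp (.mp (.thm (.all_con x _ φ hs hφx)) (.thm h1)) hl'

theorem ex_elim (hX : ∀ γ ∈ X, ¬γ.HasConst c) (hφ : ¬φ.HasConst c) (hψ : ¬ψ.HasConst c)
    (h : Der (insert (φ.inst x c) X) ψ) (h' : Der X (ex x φ)) : Der X ψ := by
  have hx := isSentence_ex.1 h'.isSentence
  have hψs := h.isSentence
  have hinst : (imp φ ψ).inst x c = imp (φ.inst x c) ψ := by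
    rw [inst]
    congr 1
    have := inst_abstr (by rw [show ψ.freeVars = ∅ from hψs]; simp)
      (substitutable_of_not_hasConst x hψ)
    rwa [abstr_of_not_hasConst x hψ] at this
  have h1 : Der X (all x (imp φ ψ)) := by
    refine all_intro hX (c := c) (by rintro (h | h) <;> contradiction) ?_
    rw [hinst]
    exact imp_intro (isSentence_inst.2 hx) h
  exact .mp (.mp (.thm (.all_ant x φ ψ hx hψs)) h1) h'

theorem eq_refl (c : σ.Const) : Der X (.eq (.const c) (.const c)) := .thm (.id_refl c)

theorem eq_sub {a b : σ.Const} (h : Der X (.eq (.const a) (.const b))) (hx : φ.freeVars ⊆ {x})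
    (hm : φ.ModalFree) (h' : Der X (φ.inst x a)) : Der X (φ.inst x b) :=
  .mp (.mp (.thm (.id_sub a b x φ hx hm)) h) h'

theorem eq_symm {a b : σ.Const} (h : Der X (.eq (.const a) (.const b))) :
    Der X (.eq (.const b) (.const a)) := by
  have := eq_sub (φ := .eq (.var 0) (.const a)) (x := 0) h (by simp [freeVars, Term.vars])
    trivial (by simpa [inst, Term.inst] using eq_refl a)
  simpa [inst, Term.inst] using this

theorem eq_trans {a b d : σ.Const} (h : Der X (.eq (.const a) (.const b)))
    (h' : Der X (.eq (.const b) (.const d))) : Der X (.eq (.const a) (.const d)) := by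
  have := eq_sub (φ := .eq (.const a) (.var 0)) (x := 0) h' (by simp [freeVars, Term.vars])
    trivial (by simpa [inst, Term.inst] using h)
  simpa [inst, Term.inst] using this

theorem pred_update {P : σ.Pred} {a : Fin (σ.arity P) → σ.Const} {i : Fin (σ.arity P)}
    {b : σ.Const} (h : Der X (.eq (.const (a i)) (.const b)))
    (h' : Der X (.pred P fun k => .const (a k))) :
    Der X (.pred P fun k => .const (Function.update a i b k)) := by
  have key : ∀ d, (Formula.pred P fun k => if k = i then Term.var 0 else .const (a k)).inst 0 d =
      .pred P fun k => .const (Function.update a i d k) := by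
    intro d
    simp only [inst]
    congr 1
    ext k
    by_cases hk : k = i <;> simp [hk, Term.inst, Function.update]
  have := eq_sub (φ := .pred P fun k => if k = i then Term.var 0 else .const (a k)) (x := 0) h
    (by
      intro v
      simp only [freeVars, Finset.mem_biUnion, Finset.mem_univ, true_and, Finset.mem_singleton]
      rintro ⟨k, hk⟩
      by_cases hki : k = i <;> simp_all [Term.vars])
    trivial (by rw [key]; simpa using h')
  rwa [key] at this

/-- The identity axiom replaces a single constant, so the arguments are exchanged one at a time. -/
theorem pred_congr {P : σ.Pred} {a b : Fin (σ.arity P) → σ.Const}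
    (h : ∀ i, Der X (.eq (.const (a i)) (.const (b i))))
    (h' : Der X (.pred P fun k => .const (a k))) : Der X (.pred P fun k => .const (b k)) := by
  classical
  have key : ∀ s : Finset (Fin (σ.arity P)),
      Der X (.pred P fun k => .const (if k ∈ s then b k else a k)) := by
    intro s
    induction s using Finset.induction_on with
    | empty => simpa using h'
    | insert i s hi ih =>
      have := pred_update (i := i) (b := b i) (by simpa [hi] using h i) ih
      convert this using 3 with k
      by_cases hk : k = i <;> simp [hk]
  simpa using key Finset.univ

/-- Constants outside a given set can be quantified away in a hypothesis. -/
theorem exists_eliminate {γ : Formula σ} (hγ : γ.IsSentence) {S : Set σ.Const} (hS : S.Finite) :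
    ∃ γ' : Formula σ, γ'.IsSentence ∧ (∀ c, γ'.HasConst c → γ.HasConst c ∧ c ∉ S) ∧
      Der {γ} γ' ∧ ∀ χ : Formula σ, (∀ c ∈ S, ¬χ.HasConst c) → Der {γ} χ → Der {γ'} χ := by
  induction S, hS using Set.Finite.induction_on with
  | empty => exact ⟨γ, hγ, fun c hc => ⟨hc, id⟩, self hγ, fun _ _ h => h⟩
  | @insert a S _ _ ih =>
    obtain ⟨γ', hs, hc, hd, hmax⟩ := ih
    obtain ⟨v, hv⟩ := exists_forall_ge_substitutable a γ'
    replace hv := hv v le_rfl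
    have hinst : (γ'.abstr a v).inst v a = γ' :=
      inst_abstr (by rw [show γ'.freeVars = ∅ from hs]; simp) hv
    have hna : ¬(γ'.abstr a v).HasConst a := fun h => h.of_abstr.2 rfl
    -- Existentially quantifying `a` loses nothing that can be said without `a`: the constant itself
    -- serves as the eigenconstant when the quantifier is eliminated.
    refine ⟨ex v (γ'.abstr a v), isSentence_ex.2 (freeVars_abstr_of_isSentence hs a),
      fun c h => ?_, ?_, fun χ hχ h => ?_⟩
    · have := HasConst.of_abstr (show (γ'.abstr a v).HasConst c from h)
      exact ⟨(hc c this.1).1, by simp [this.2, (hc c this.1).2]⟩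
    · exact ex_intro (c := a) (hinst.symm ▸ hd)
    · have h1 := hmax χ (fun c hc => hχ c (.inr hc)) h
      refine ex_elim (c := a) (by rintro _ rfl; exact hna) hna (hχ a (.inl rfl)) ?_
        (self (isSentence_ex.2 (freeVars_abstr_of_isSentence hs a)))
      rw [hinst]
      exact h1.mono (by simp)

/-- An interpolation property. The consequence `χ` need not be over `D`; it only has to avoid the
constants of `γ` outside `D`, so it may contain constants that are new to `γ`. -/
theorem exists_restrict {γ : Formula σ} (hγ : γ.IsSentence) (D : Set σ.Const) :
    ∃ γ' ∈ Sent D, Der {γ} γ' ∧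
      ∀ χ : Formula σ, (∀ c, γ.HasConst c → c ∉ D → ¬χ.HasConst c) → Der {γ} χ → Der {γ'} χ := by
  obtain ⟨γ', h1, h2, h3, h4⟩ := exists_eliminate hγ
    (γ.finite_hasConst.subset (Set.sep_subset {c | γ.HasConst c} fun c => c ∉ D))
  refine ⟨γ', ⟨h1, fun c hc => ?_⟩, h3, fun χ hχ => h4 χ fun c hc => hχ c hc.1 hc.2⟩
  by_contra hD
  exact (h2 c hc).2 ⟨(h2 c hc).1, hD⟩

end Der

theorem Der.dia_or {X : Set (Formula σ)} {φ ψ : Formula σ} (h : Der X (dia (or φ ψ))) :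
    Der X (or (dia φ) (dia ψ)) :=
  have hs := isSentence_or.1 (isSentence_dia.1 h.isSentence)
  .mp (Der.and_left (.thm (.dia_or φ ψ hs.1 hs.2))) h

/-! ### Theories -/

/-- `A` is a deductively closed set of sentences over `D`. -/
structure IsTheory (D : Set σ.Const) (A : Set (Formula σ)) : Prop where
  sent : A ⊆ Sent D
  closed : ∀ {φ}, φ ∈ Sent D → Der A φ → φ ∈ A

namespace IsTheory

variable {D : Set σ.Const} {A : Set (Formula σ)} {φ ψ : Formula σ}

theorem hyp (hA : IsTheory D A) (h : φ ∈ A) : Der A φ := .hyp h (hA.sent h).1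

theorem top_mem (hA : IsTheory D A) : top ∈ A := hA.closed top_mem_sent .top_intro

theorem and_mem (hA : IsTheory D A) (h1 : φ ∈ A) (h2 : ψ ∈ A) : and φ ψ ∈ A :=
  hA.closed (and_mem_sent.2 ⟨hA.sent h1, hA.sent h2⟩) ((hA.hyp h1).and_intro (hA.hyp h2))

theorem mem_of_der (hA : IsTheory D A) (h : φ ∈ A) (hψ : ψ ∈ Sent D) (hd : Der {φ} ψ) : ψ ∈ A :=
  hA.closed hψ ((hA.hyp h).trans hd)

/-- A theory is closed under conjunction, so the finitely many premises merge into one. -/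
theorem exists_mem_der (hA : IsTheory D A) (h : Der A φ) : ∃ γ ∈ A, Der {γ} φ := by
  have h' : Der (∅ ∪ A) φ := by simpa using h
  obtain ⟨γ, hγ, hd⟩ := Der.exists_of_directed ⟨_, hA.top_mem⟩ (fun a ha b hb =>
    ⟨_, hA.and_mem ha hb, (Der.self (hA.sent (hA.and_mem ha hb)).1).and_left,
      (Der.self (hA.sent (hA.and_mem ha hb)).1).and_right⟩) h'
  exact ⟨γ, hγ, by simpa using hd⟩

/-- Compactness for the sentences necessitated by a theory. -/
theorem exists_box (hA : IsTheory D A) {X : Set (Formula σ)}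
    (h : Der (X ∪ {β | box β ∈ A}) φ) : ∃ β, box β ∈ A ∧ Der (insert β X) φ := by
  refine Der.exists_of_directed ⟨top, hA.closed (box_mem_sent.2 top_mem_sent) .box_top⟩
    (fun a ha b hb => ⟨and a b, hA.closed ?_ ((hA.hyp ha).box_and_intro (hA.hyp hb)), ?_⟩) h
  · exact and_mem_sent.2 ⟨box_mem_sent.1 (hA.sent ha), box_mem_sent.1 (hA.sent hb)⟩
  · have : (and a b).IsSentence := isSentence_and.2
      ⟨(box_mem_sent.1 (hA.sent ha)).1, (box_mem_sent.1 (hA.sent hb)).1⟩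
    exact ⟨(Der.self this).and_left, (Der.self this).and_right⟩

/-- Compactness for the possibilities contributed by a theory. -/
theorem exists_dia (hA : IsTheory D A) {D' : Set σ.Const} {X : Set (Formula σ)}
    (h : Der (X ∪ dia '' (A ∩ Sent D')) φ) : ∃ α ∈ A ∩ Sent D', Der (insert (dia α) X) φ := by
  obtain ⟨_, ⟨α, hα, rfl⟩, hd⟩ := Der.exists_of_directed (A := dia '' (A ∩ Sent D'))
    ⟨dia top, top, ⟨hA.top_mem, top_mem_sent⟩, rfl⟩ (by
      rintro _ ⟨a, ha, rfl⟩ _ ⟨b, hb, rfl⟩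
      have hab : and a b ∈ Sent D' := and_mem_sent.2 ⟨ha.2, hb.2⟩
      refine ⟨_, ⟨and a b, ⟨hA.and_mem ha.1 hb.1, hab⟩, rfl⟩, ?_, ?_⟩
      · exact .dia_mono hab.1 (Der.self hab.1).and_left (Der.self (isSentence_dia.2 hab.1))
      · exact .dia_mono hab.1 (Der.self hab.1).and_right (Der.self (isSentence_dia.2 hab.1))) h
  exact ⟨α, hα, hd⟩

end IsTheory

/-- The consequences over `D` of `G` together with `A`, if `G` is nonempty. -/
def join (D : Set σ.Const) (G A : Set (Formula σ)) : Set (Formula σ) :=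
  {χ | χ ∈ Sent D ∧ G.Nonempty ∧ Der (G ∪ A) χ}

section join

variable {D : Set σ.Const} {G A : Set (Formula σ)}

theorem isTheory_join (hG : G.Nonempty) : IsTheory D (join D G A) :=
  ⟨fun _ h => h.1, fun h h' => ⟨h, hG, h'.cut fun _ hψ _ => hψ.2.2⟩⟩

theorem subset_join (hG : G ⊆ Sent D) : G ⊆ join D G A :=
  fun _ h => ⟨hG h, ⟨_, h⟩, .hyp (.inl h) (hG h).1⟩

end join

/-! ### Families of theories on a tree -/

/-- A family of theories indexed by the nodes of a tree. A node is a list of constants, and its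
children are obtained by consing. The theory of a node is empty when the node is not active. -/
@[ext]
structure Fam (σ : Signature.{u}) : Type u where
  dom : List σ.Const → Set σ.Const
  T : List σ.Const → Set (Formula σ)
  dom_cons : ∀ n x, dom x ⊆ dom (n :: x)
  theory : ∀ x, (T x).Nonempty → IsTheory (dom x) (T x)
  active : ∀ n x, (T (n :: x)).Nonempty → (T x).Nonempty
  box_mem : ∀ n x φ, (T (n :: x)).Nonempty → box φ ∈ T x → φ ∈ T (n :: x)
  dia_mem : ∀ n x φ, φ ∈ T (n :: x) → φ ∈ Sent (dom x) → dia φ ∈ T x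

namespace Fam

instance : PartialOrder (Fam σ) where
  le G H := (∀ x, G.dom x ⊆ H.dom x) ∧ ∀ x, G.T x ⊆ H.T x
  le_refl _ := ⟨fun _ => subset_rfl, fun _ => subset_rfl⟩
  le_trans _ _ _ h h' := ⟨fun x => (h.1 x).trans (h'.1 x), fun x => (h.2 x).trans (h'.2 x)⟩
  le_antisymm _ _ h h' := Fam.ext (funext fun x => (h.1 x).antisymm (h'.1 x))
    (funext fun x => (h.2 x).antisymm (h'.2 x))

variable (G : Fam σ)

theorem sent {x : List σ.Const} {φ : Formula σ} (h : φ ∈ G.T x) : φ ∈ Sent (G.dom x) :=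
  (G.theory x ⟨_, h⟩).sent h

theorem active_of_append (l x : List σ.Const) (h : (G.T (l ++ x)).Nonempty) :
    (G.T x).Nonempty := by
  induction l with
  | nil => exact h
  | cons m l ih => exact ih (G.active m _ h)

/-! ### Propagating a change of one theory through the tree -/

/-- The change of the theory of `x` induced by the set `A` of sentences at a child of `x`. -/
def lift (x : List σ.Const) (A : Set (Formula σ)) : Set (Formula σ) :=
  join (G.dom x) (G.T x) (dia '' (A ∩ Sent (G.dom x)))

/-- The domains after adding the constants `E` at the node `y`. -/
def newDom (y : List σ.Const) (E : Set σ.Const) (z : List σ.Const) : Set σ.Const :=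
  {c | c ∈ G.dom z ∨ c ∈ E ∧ y <:+ z}

/-- The theories on the path from the root to `y` after replacing the theory of `y` by `A`. -/
noncomputable def spine : List σ.Const → Set (Formula σ) → List σ.Const → Set (Formula σ)
  | [], A, _ => A
  | n :: y, A, z => open Classical in if z = n :: y then A else spine y (G.lift y A) z

/-- The theories after adding the constants `E` at `y` and replacing the theory of `y` by `A`. -/
noncomputable def prop (y : List σ.Const) (E : Set σ.Const) (A : Set (Formula σ)) :
    List σ.Const → Set (Formula σ)
  | [] => G.spine y A []
  | n :: z => open Classical in if n :: z <:+ y then G.spine y A (n :: z) else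
      join (G.newDom y E (n :: z)) (G.T (n :: z)) {β | box β ∈ prop y E A z}

theorem spine_self (y : List σ.Const) (A : Set (Formula σ)) : G.spine y A y = A := by
  cases y <;> simp [spine]

/-- `spine` recurses from `y` towards the root; this is the resulting local relation between
neighbours anywhere on the path. -/
theorem spine_lift {n : σ.Const} {y z : List σ.Const} (A : Set (Formula σ)) (h : n :: z <:+ y) :
    G.spine y A z = G.lift z (G.spine y A (n :: z)) := by
  induction y generalizing A with
  | nil => simp at h
  | cons m y ih =>
    rcases List.suffix_cons_iff.1 h with h | h
    · obtain ⟨rfl, rfl⟩ := List.cons.inj h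
      simp [spine, spine_self]
    · have hl := h.length_le
      have h1 : z ≠ m :: y := by rintro rfl; simp at hl
      have h2 : n :: z ≠ m :: y := by rintro h2; rw [h2] at hl; simp at hl
      simp [spine, h1, h2, ih _ h]

variable {G} {y : List σ.Const} {E : Set σ.Const} {A : Set (Formula σ)}

theorem prop_of_suffix {z : List σ.Const} (h : z <:+ y) : G.prop y E A z = G.spine y A z := by
  cases z <;> simp [prop, h]

theorem prop_self : G.prop y E A y = A := by rw [prop_of_suffix List.suffix_rfl, spine_self]

/-- Together with `prop_self` and `prop_join` this characterizes `prop`: a start value at `y`, one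
rule on the path and one rule off it, matching the cases of `tree_induction`. -/
theorem prop_lift {n : σ.Const} {z : List σ.Const} (h : n :: z <:+ y) :
    G.prop y E A z = G.lift z (G.prop y E A (n :: z)) := by
  rw [prop_of_suffix h, prop_of_suffix ((List.suffix_cons _ _).trans h), spine_lift G A h]

theorem prop_join {n : σ.Const} {z : List σ.Const} (h : ¬n :: z <:+ y) :
    G.prop y E A (n :: z) =
      join (G.newDom y E (n :: z)) (G.T (n :: z)) {β | box β ∈ G.prop y E A z} := by
  simp [prop, h]

/-- Induction over the nodes of the tree starting from `y`. -/
theorem tree_induction {C : Type*} {Q : List C → Prop} (y : List C) (self : Q y)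
    (up : ∀ n z, n :: z <:+ y → Q (n :: z) → Q z)
    (down : ∀ n z, ¬n :: z <:+ y → Q z → Q (n :: z)) (z : List C) : Q z := by
  -- The path from `y` to the root is climbed first; every other node is then reached by descending
  -- from it.
  have h : ∀ l z, l ++ z = y → Q z := by
    intro l
    induction l using List.reverseRecOn with
    | nil => rintro z rfl; exact self
    | append_singleton l n ih =>
      intro z hz
      have hz' : l ++ n :: z = y := by simpa using hz
      exact up n z ⟨l, hz'⟩ (ih _ hz')
  induction z with
  | nil => exact h y [] (by simp)
  | cons n z ih =>
    by_cases hn : n :: z <:+ y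
    · obtain ⟨l, hl⟩ := hn
      exact h l _ hl
    · exact down n z hn ih

/-- New constants appear at `y` and below it, never at a proper ancestor. -/
theorem newDom_of_cons_suffix {n : σ.Const} {z : List σ.Const} (h : n :: z <:+ y) :
    G.newDom y E z = G.dom z := by
  ext c
  refine ⟨fun hc => hc.elim id fun hc => ?_, .inl⟩
  have h1 := h.length_le
  have h2 := hc.2.length_le
  simp at h1
  omega

theorem dom_subset_newDom (z : List σ.Const) : G.dom z ⊆ G.newDom y E z := fun _ => .inl

theorem newDom_cons (n : σ.Const) (z : List σ.Const) :
    G.newDom y E z ⊆ G.newDom y E (n :: z) :=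
  fun _ h => h.imp (fun h => G.dom_cons n z h) fun h => ⟨h.1, h.2.trans (List.suffix_cons _ _)⟩

variable (G y E A) in
/-- The theory of the active node `y` can be replaced by `A`, with new constants `E`. -/
structure Extension : Prop where
  active : (G.T y).Nonempty
  fresh : ∀ z, ∀ c ∈ E, c ∉ G.dom z
  sub : G.T y ⊆ A
  theory : IsTheory (G.newDom y E y) A

/-! ### Correctness and conservativity of the propagation -/

namespace Extension

variable (h : G.Extension y E A)
include h

theorem subset_prop (z : List σ.Const) : G.T z ⊆ G.prop y E A z := by
  induction z using tree_induction y with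
  | self => rw [prop_self]; exact h.sub
  | up n z hz _ =>
    rw [prop_lift hz]
    exact subset_join fun _ => G.sent
  | down n z hz _ =>
    rw [prop_join hz]
    exact subset_join fun _ hφ => Sent.mono (dom_subset_newDom _) (G.sent hφ)

theorem nonempty_of_prop {z : List σ.Const} (hz : (G.prop y E A z).Nonempty) :
    (G.T z).Nonempty := by
  induction z using tree_induction y with
  | self => exact h.active
  | up n z hn _ =>
    rw [prop_lift hn] at hz
    obtain ⟨_, hz⟩ := hz
    exact hz.2.1
  | down n z hn _ =>
    rw [prop_join hn] at hz
    obtain ⟨_, hz⟩ := hz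
    exact hz.2.1

theorem isTheory_prop {z : List σ.Const} (hz : (G.T z).Nonempty) :
    IsTheory (G.newDom y E z) (G.prop y E A z) := by
  induction z using tree_induction y with
  | self => rw [prop_self]; exact h.theory
  | up n z hn _ =>
    rw [prop_lift hn, newDom_of_cons_suffix hn]
    exact isTheory_join hz
  | down n z hn _ =>
    rw [prop_join hn]
    exact isTheory_join hz

/-- The family obtained by replacing the theory of `y` by `A`. -/
noncomputable def fam : Fam σ where
  dom := G.newDom y E
  T := G.prop y E A
  dom_cons := newDom_cons
  theory x hx := h.isTheory_prop (h.nonempty_of_prop hx)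
  active n x hx := (G.active n x (h.nonempty_of_prop hx)).mono (h.subset_prop x)
  box_mem n x φ hx hφ := by
    have hn := h.nonempty_of_prop hx
    have hG := G.theory x (G.active n x hn)
    by_cases hs : n :: x <:+ y
    · have hP := h.isTheory_prop hn
      rw [prop_lift hs] at hφ
      obtain ⟨hφ1, -, hφ2⟩ := hφ
      obtain ⟨α, hα, hd⟩ := hP.exists_dia hφ2
      -- On the path, `□φ` was derived from the old theory and one `◇α`. The first Fischer Servi
      -- axiom turns `◇α → □φ` into `□(α → φ)`, which the old family already passed to the child,
      -- where `α` now holds.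
      have h1 : box (imp α φ) ∈ G.T x :=
        hG.closed (imp_mem_sent.2 ⟨hα.2, hφ1⟩)
          (Der.box_imp_intro (Der.imp_intro hα.2.1 hd))
      have h2 := h.subset_prop _ (G.box_mem n x _ hn h1)
      refine hP.closed (Sent.mono ?_ (box_mem_sent.1 hφ1)) (.mp (hP.hyp h2) (hP.hyp hα.1))
      exact (G.dom_cons n x).trans (dom_subset_newDom _)
    · have hP := h.isTheory_prop (G.active n x hn)
      have hφ' := box_mem_sent.1 (hP.sent hφ)
      rw [prop_join hs]
      exact ⟨Sent.mono (newDom_cons n x) hφ', hn, .hyp (.inr hφ) hφ'.1⟩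
  dia_mem n x φ hφ hφs := by
    have hn := h.nonempty_of_prop ⟨_, hφ⟩
    have hx := G.active n x hn
    by_cases hs : n :: x <:+ y
    · rw [prop_lift hs]
      rw [newDom_of_cons_suffix hs] at hφs
      exact ⟨dia_mem_sent.2 hφs, hx, .hyp (.inr ⟨φ, ⟨hφ, hφs⟩, rfl⟩) hφs.1⟩
    · have hP := h.isTheory_prop hx
      rw [prop_join hs] at hφ
      obtain ⟨β, hβ, hd⟩ := hP.exists_box hφ.2.2
      have hβs := box_mem_sent.1 (hP.sent hβ)
      obtain ⟨γ, hγ, hγd⟩ := (G.theory _ hn).exists_mem_der (hd.imp_intro hβs.1)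
      have hγs := G.sent hγ
      -- `◇γ` may not be expressible at `x`, so `γ` is replaced by an interpolant over the old
      -- domain of `x`. It still implies `β → φ`, since any constants these have beyond that domain
      -- are fresh and hence absent from `γ`. From `◇(β → φ)` and `□β`, the second Fischer Servi
      -- axiom gives `◇φ`.
      obtain ⟨γ', hγ', hγγ', hmax⟩ := Der.exists_restrict hγs.1 (G.dom x)
      have h1 : dia γ' ∈ G.T x := G.dia_mem n x γ' ((G.theory _ hn).mem_of_der hγ
        (Sent.mono (G.dom_cons n x) hγ') hγγ') hγ'
      have h2 : Der {γ'} (imp β φ) := by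
        refine hmax _ (fun c hc hcx hc' => ?_) hγd
        have : c ∈ G.newDom y E x := hc'.elim (hβs.2 c) (hφs.2 c)
        rcases this with h3 | h3
        · exact hcx h3
        · exact h.fresh _ c h3.1 (hγs.2 c hc)
      exact hP.closed (dia_mem_sent.2 hφs)
        ((Der.dia_mono hγ'.1 h2 (hP.hyp (h.subset_prop x h1))).dia_imp_elim (hP.hyp hβ))

theorem le_fam : G ≤ h.fam := ⟨dom_subset_newDom, h.subset_prop⟩

theorem fam_self : h.fam.T y = A := prop_self

/-- An extension that is conservative at `y` is conservative at every node. -/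
theorem conservative (hA : A ∩ Sent (G.dom y) ⊆ G.T y) (z : List σ.Const) :
    G.prop y E A z ∩ Sent (G.dom z) ⊆ G.T z := by
  induction z using tree_induction y with
  | self => rwa [prop_self]
  | up n z hn ih =>
    rw [prop_lift hn]
    rintro χ ⟨⟨hχ, hz, hd⟩, -⟩
    refine (G.theory z hz).closed hχ (hd.cut ?_)
    rintro _ (h1 | ⟨α, hα, rfl⟩) hs
    · exact .hyp h1 hs
    · exact .hyp (G.dia_mem n z α (ih ⟨hα.1, Sent.mono (G.dom_cons n z) hα.2⟩) hα.2) hs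
  | down n z hn ih =>
    rw [prop_join hn]
    rintro χ ⟨⟨-, hz, hd⟩, hχ⟩
    have hG := G.theory _ hz
    have hP := h.isTheory_prop (G.active n z hz)
    obtain ⟨β, hβ, hd⟩ := hP.exists_box hd
    have hβs := box_mem_sent.1 (hP.sent hβ)
    obtain ⟨γ, hγ, hγd⟩ := hG.exists_mem_der (hd.imp_intro hβs.1)
    have hγs := G.sent hγ
    -- Here the interpolant removes the fresh constants from `β`, so that the induction hypothesis
    -- applies to the box of the result.
    obtain ⟨β', hβ', hββ', hmax⟩ := Der.exists_restrict hβs.1 (G.dom z)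
    have h1 : Der {β} (imp γ χ) := by
      refine Der.imp_intro hγs.1 (.mp (hγd.mono (by simp)) (.hyp (by simp) hβs.1))
    have h2 : Der {β'} (imp γ χ) := by
      refine hmax _ (fun c hc hcz hc' => ?_) h1
      have hE : c ∈ E := ((hβs.2 c hc).resolve_left hcz).1
      exact h.fresh (n :: z) c hE (hc'.elim (hγs.2 c) (hχ.2 c))
    have h3 : box β' ∈ G.T z := ih ⟨hP.closed
      (box_mem_sent.2 (Sent.mono (dom_subset_newDom _) hβ')) (.box_mono hβs.1 hββ' (hP.hyp hβ)),
      box_mem_sent.2 hβ'⟩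
    exact hG.closed hχ (.mp ((hG.hyp (G.box_mem n z _ hz h3)).trans h2) (hG.hyp hγ))

/-- Propagation preserves intersections. -/
theorem inter {B C : Set (Formula σ)} (h' : G.Extension y E B) (hC : A ∩ B ⊆ C)
    (z : List σ.Const) : G.prop y E A z ∩ G.prop y E B z ⊆ G.prop y E C z := by
  induction z using tree_induction y with
  | self => rwa [prop_self, prop_self, prop_self]
  | up n z hn ih =>
    have hne : (G.T (n :: z)).Nonempty := by
      obtain ⟨l, hl⟩ := hn
      exact G.active_of_append l _ (hl ▸ h.active)
    have hP := h.isTheory_prop hne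
    have hQ := h'.isTheory_prop hne
    rw [prop_lift hn, prop_lift (A := B) hn, prop_lift (A := C) hn]
    rintro χ ⟨⟨hχ, hz, hd⟩, -, -, hd'⟩
    obtain ⟨α, hα, hd⟩ := hP.exists_dia hd
    obtain ⟨β, hβ, hd'⟩ := hQ.exists_dia hd'
    have hs := or_mem_sent.2 ⟨hα.2, hβ.2⟩
    have hs' := or_mem_sent.2 ⟨hP.sent hα.1, hQ.sent hβ.1⟩
    -- The disjunction lies in both changed theories, hence in the third by induction; `◇`
    -- distributes over it, and each disjunct yields `χ`.
    have h1 : or α β ∈ G.prop y E C (n :: z) :=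
      ih ⟨hP.mem_of_der hα.1 hs' ((Der.self hα.2.1).or_left hβ.2.1),
        hQ.mem_of_der hβ.1 hs' (.or_right hα.2.1 (Der.self hβ.2.1))⟩
    exact ⟨hχ, hz, Der.or_elim (Der.dia_or (.hyp (.inr ⟨_, ⟨h1, hs⟩, rfl⟩) hs.1))
      (hd.mono (Set.insert_subset_insert Set.subset_union_left))
      (hd'.mono (Set.insert_subset_insert Set.subset_union_left))⟩
  | down n z hn ih =>
    rw [prop_join hn, prop_join (A := B) hn, prop_join (A := C) hn]
    rintro χ ⟨⟨hχ, hz, hd⟩, -, -, hd'⟩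
    have hP := h.isTheory_prop (G.active n z hz)
    have hQ := h'.isTheory_prop (G.active n z hz)
    obtain ⟨α, hα, hd⟩ := hP.exists_box hd
    obtain ⟨β, hβ, hd'⟩ := hQ.exists_box hd'
    have hαs := box_mem_sent.1 (hP.sent hα)
    have hβs := box_mem_sent.1 (hQ.sent hβ)
    have hs := or_mem_sent.2 ⟨hαs, hβs⟩
    -- Only monotonicity of `□` is needed here: `□α` and `□β` each imply `□(α ∨ β)`.
    have h1 : box (or α β) ∈ G.prop y E C z :=
      ih ⟨hP.closed (box_mem_sent.2 hs)
          (.box_mono hαs.1 ((Der.self hαs.1).or_left hβs.1) (hP.hyp hα)),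
        hQ.closed (box_mem_sent.2 hs)
          (.box_mono hβs.1 (.or_right hαs.1 (Der.self hβs.1)) (hQ.hyp hβ))⟩
    exact ⟨hχ, hz, Der.or_elim (.hyp (.inr h1) hs.1)
      (hd.mono (Set.insert_subset_insert Set.subset_union_left))
      (hd'.mono (Set.insert_subset_insert Set.subset_union_left))⟩

end Extension

end Fam

/-! ### Adding a single witness or counterexample to a family -/

namespace Fam

/-- All constants and all labels of active nodes lie in `U`. -/
def Supported (G : Fam σ) (U : Set σ.Const) : Prop :=
  (∀ z, G.dom z ⊆ U) ∧ ∀ n z, (G.T (n :: z)).Nonempty → n ∈ U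

variable {G : Fam σ} {U E B : Set σ.Const} {x y : List σ.Const} {φ ψ χ : Formula σ}

theorem Supported.mono {V : Set σ.Const} (hG : G.Supported U) (h : U ⊆ V) : G.Supported V :=
  ⟨fun z => (hG.1 z).trans h, fun n z hz => h (hG.2 n z hz)⟩

theorem Extension.supported {A : Set (Formula σ)} (h : G.Extension y E A) (hG : G.Supported U) :
    h.fam.Supported (E ∪ U) := by
  refine ⟨?_, fun n z hz => .inr (hG.2 n z (h.nonempty_of_prop hz))⟩
  rintro z c (hc | hc)
  · exact .inr (hG.1 z hc)
  · exact .inl hc.1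

theorem newDom_empty (z : List σ.Const) : G.newDom y ∅ z = G.dom z := by
  ext c
  simp [newDom]

/-- Any set of sentences can be added to the theory of an active node. -/
theorem extension_join (X : Set (Formula σ)) (hy : (G.T y).Nonempty)
    (hE : ∀ z, ∀ c ∈ E, c ∉ G.dom z) :
    G.Extension y E (join (G.newDom y E y) (G.T y) X) :=
  ⟨hy, hE, subset_join fun _ h => Sent.mono (dom_subset_newDom _) (G.sent h), isTheory_join hy⟩

theorem extension_join_empty (X : Set (Formula σ)) (hy : (G.T y).Nonempty) :
    G.Extension y ∅ (join (G.newDom y ∅ y) (G.T y) X) :=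
  extension_join X hy (by simp)

/-- If adding either disjunct at `y` forced `χ` at the possibly distant node `x`, then by
preservation of intersections the unchanged theory of `y` would force it too. -/
theorem exists_or (h : or φ ψ ∈ G.T y) (hχ : χ ∈ Sent (G.dom x)) (hx : χ ∉ G.T x)
    (hG : G.Supported U) :
    ∃ H, G ≤ H ∧ χ ∉ H.T x ∧ (φ ∈ H.T y ∨ ψ ∈ H.T y) ∧ H.Supported U := by
  have hs := or_mem_sent.1 (G.sent h)
  have h1 := extension_join_empty {φ} ⟨_, h⟩
  have h2 := extension_join_empty {ψ} ⟨_, h⟩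
  -- The trivial extension is the third member in `Extension.inter`; being conservative, it adds
  -- nothing in the old language.
  have h0 : G.Extension y ∅ (G.T y) :=
    ⟨⟨_, h⟩, by simp, subset_rfl, by rw [newDom_empty]; exact G.theory y ⟨_, h⟩⟩
  by_cases hx1 : χ ∈ h1.fam.T x
  · by_cases hx2 : χ ∈ h2.fam.T x
    · refine absurd (h0.conservative Set.inter_subset_left x ⟨h1.inter h2 ?_ x ⟨hx1, hx2⟩, hχ⟩) hx
      rw [newDom_empty]
      rintro θ ⟨⟨hθ, -, hd⟩, -, -, hd'⟩
      rw [Set.union_singleton] at hd hd'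
      exact (G.theory y ⟨_, h⟩).closed hθ (.or_elim (.hyp h (G.sent h).1) hd hd')
    · refine ⟨h2.fam, h2.le_fam, hx2, .inr ?_, by simpa using h2.supported hG⟩
      rw [h2.fam_self, newDom_empty]
      exact ⟨hs.2, ⟨_, h⟩, .hyp (.inr rfl) hs.2.1⟩
  · refine ⟨h1.fam, h1.le_fam, hx1, .inl ?_, by simpa using h1.supported hG⟩
    rw [h1.fam_self, newDom_empty]
    exact ⟨hs.1, ⟨_, h⟩, .hyp (.inr rfl) hs.1.1⟩

theorem inst_mem_newDom {v : ℕ} {c : σ.Const} (hv : φ.freeVars ⊆ {v})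
    (h : ∀ d, φ.HasConst d → d ∈ G.dom y) : φ.inst v c ∈ Sent (G.newDom y {c} y) :=
  inst_mem_sent hv (fun d hd => .inl (h d hd)) (.inr ⟨rfl, List.suffix_rfl⟩)

/-- A fresh witness is conservative at `y` by existential elimination, hence conservative at `x` as
well. -/
theorem exists_ex {v : ℕ} {c : σ.Const} (h : ex v φ ∈ G.T y) (hχ : χ ∈ Sent (G.dom x))
    (hx : χ ∉ G.T x) (hG : G.Supported U) (hc : c ∉ U) :
    ∃ H, G ≤ H ∧ χ ∉ H.T x ∧ (c ∈ H.dom y ∧ φ.inst v c ∈ H.T y) ∧ H.Supported (insert c U) := by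
  have hs := G.sent h
  have hfresh : ∀ z, c ∉ G.dom z := fun z hz => hc (hG.1 z hz)
  have h1 := extension_join {φ.inst v c} ⟨_, h⟩
    (show ∀ z, ∀ d ∈ ({c} : Set σ.Const), d ∉ G.dom z by rintro z _ rfl; exact hfresh z)
  refine ⟨h1.fam, h1.le_fam, fun hx1 => hx (h1.conservative ?_ x ⟨hx1, hχ⟩),
    ⟨.inr ⟨rfl, List.suffix_rfl⟩, ?_⟩, by simpa using h1.supported hG⟩
  · rintro θ ⟨⟨-, -, hd⟩, hθ⟩
    rw [Set.union_singleton] at hd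
    exact (G.theory y ⟨_, h⟩).closed hθ (.ex_elim (fun γ hγ hγc => hfresh y ((G.sent hγ).2 c hγc))
      (x := v) (φ := φ)
      (fun hc' => hfresh y (hs.2 c hc')) (fun hc' => hfresh y (hθ.2 c hc')) hd
      (.hyp h hs.1))
  · rw [h1.fam_self]
    have := inst_mem_newDom (G := G) (y := y) (c := c) (isSentence_ex.1 hs.1) hs.2
    exact ⟨this, ⟨_, h⟩, .hyp (.inr rfl) this.1⟩

/-- Only the fresh constant is added at `y`, with no new hypothesis; if its instance followed, it
could be generalized. -/
theorem exists_all {v : ℕ} {c : σ.Const} (hy : (G.T y).Nonempty)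
    (hs : all v φ ∈ Sent (G.dom y)) (h : all v φ ∉ G.T y) (hG : G.Supported U) (hc : c ∉ U) :
    ∃ H, G ≤ H ∧ c ∈ H.dom y ∧ φ.inst v c ∉ H.T y ∧ H.Supported (insert c U) := by
  have hfresh : ∀ z, c ∉ G.dom z := fun z hz => hc (hG.1 z hz)
  have h1 := extension_join ∅ hy
    (show ∀ z, ∀ d ∈ ({c} : Set σ.Const), d ∉ G.dom z by rintro z _ rfl; exact hfresh z)
  refine ⟨h1.fam, h1.le_fam, .inr ⟨rfl, List.suffix_rfl⟩, fun hφ => h ?_,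
    by simpa using h1.supported hG⟩
  rw [h1.fam_self] at hφ
  have hd := hφ.2.2
  rw [Set.union_empty] at hd
  exact (G.theory y hy).closed hs (.all_intro (fun γ hγ hγc => hfresh y ((G.sent hγ).2 c hγc))
    (fun hc' => hfresh y (hs.2 c hc')) hd)

theorem exists_imp (hy : (G.T y).Nonempty) (hs : imp φ ψ ∈ Sent (G.dom y)) (h : imp φ ψ ∉ G.T y)
    (hG : G.Supported U) : ∃ H, G ≤ H ∧ φ ∈ H.T y ∧ ψ ∉ H.T y ∧ H.Supported U := by
  have hs' := imp_mem_sent.1 hs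
  have h1 := extension_join_empty {φ} hy
  refine ⟨h1.fam, h1.le_fam, ?_, fun hψ => h ?_, by simpa using h1.supported hG⟩
  · rw [h1.fam_self, newDom_empty]
    exact ⟨hs'.1, hy, .hyp (.inr rfl) hs'.1.1⟩
  · rw [h1.fam_self] at hψ
    have hd := hψ.2.2
    rw [Set.union_singleton] at hd
    exact (G.theory y hy).closed hs (.imp_intro hs'.1.1 hd)

/-- A possibility at `y` can be realized at a new child of `y`. -/
theorem exists_child {n : σ.Const} (h : dia φ ∈ G.T y) (hG : G.Supported U) (hn : n ∉ U) :
    ∃ H, G ≤ H ∧ (∀ x, (G.T x).Nonempty → H.T x = G.T x) ∧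
      H.T (n :: y) = join (G.dom (n :: y)) {β | box β ∈ G.T y} {φ} ∧ H.dom = G.dom ∧
      H.Supported (insert n U) := by
  classical
  have hy := G.theory y ⟨_, h⟩
  have hφ := dia_mem_sent.1 (hy.sent h)
  -- The label `n` is unused, so the new child and everything below it were inactive. Only the edge
  -- from `y` to the child needs checking.
  have hne : ∀ z, ¬(G.T (n :: z)).Nonempty := fun z hz => hn (hG.2 n z hz)
  have hne' : ∀ m z, ¬(G.T (m :: n :: z)).Nonempty := fun m z hz => hne z (G.active m _ hz)
  have hyn : y ≠ n :: y := fun h => by simpa using congrArg List.length h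
  have hb : {β | box β ∈ G.T y}.Nonempty := ⟨top, hy.closed top_mem_sent .box_top⟩
  set J := join (G.dom (n :: y)) {β | box β ∈ G.T y} {φ} with hJ
  set T' := Function.update G.T (n :: y) J with hT'
  have hself : T' (n :: y) = J := Function.update_self ..
  have hother : ∀ {z}, z ≠ n :: y → T' z = G.T z := fun hz => Function.update_of_ne hz ..
  have hsub : ∀ z, G.T z ⊆ T' z := by
    intro z
    by_cases hz : z = n :: y
    · subst hz
      exact fun θ hθ => (hne y ⟨θ, hθ⟩).elim
    · rw [hother hz]
  refine ⟨⟨G.dom, T', G.dom_cons, fun z hz => ?_, fun m z hz => ?_, fun m z θ hz hθ => ?_,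
    fun m z θ hθ hθs => ?_⟩, ⟨fun _ => subset_rfl, hsub⟩, fun x hx => hother ?_, hself, rfl,
    fun z => (hG.1 z).trans (Set.subset_insert _ _), fun m z hz => ?_⟩
  · by_cases hzn : z = n :: y
    · subst hzn
      rw [hself]
      exact isTheory_join hb
    · rw [hother hzn] at hz ⊢
      exact G.theory z hz
  · by_cases hzn : m :: z = n :: y
    · obtain ⟨-, rfl⟩ := List.cons.inj hzn
      exact ⟨_, hsub z h⟩
    · rw [hother hzn] at hz
      exact (G.active m z hz).mono (hsub z)
  · by_cases hzn : m :: z = n :: y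
    · obtain ⟨rfl, rfl⟩ := List.cons.inj hzn
      rw [hother hyn] at hθ
      rw [hself]
      have := box_mem_sent.1 (G.sent hθ)
      exact ⟨Sent.mono (G.dom_cons _ _) this, hb, .hyp (.inl hθ) this.1⟩
    · rw [hother hzn] at hz ⊢
      have hz' : z ≠ n :: y := fun e => hne' m y (e ▸ hz)
      rw [hother hz'] at hθ
      exact G.box_mem m z θ hz hθ
  · by_cases hzn : m :: z = n :: y
    · obtain ⟨rfl, rfl⟩ := List.cons.inj hzn
      rw [hother hyn]
      rw [hself] at hθ
      have hd := hθ.2.2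
      rw [Set.union_comm] at hd
      obtain ⟨β, hβ, hd⟩ := hy.exists_box hd
      have hβs := (box_mem_sent.1 (hy.sent hβ)).1
      -- `◇φ` gives `◇(β → θ)`, and `□β` then gives `◇θ`.
      exact hy.closed (dia_mem_sent.2 hθs)
        ((Der.dia_mono hφ.1 (hd.imp_intro hβs) (hy.hyp h)).dia_imp_elim (hy.hyp hβ))
    · rw [hother hzn] at hθ
      have hz' : z ≠ n :: y := fun e => hne' m y (e ▸ ⟨_, hθ⟩)
      rw [hother hz']
      exact G.dia_mem m z θ hθ hθs
  · rintro rfl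
    exact hne y hx
  · by_cases hzn : m :: z = n :: y
    · exact .inl (List.cons.inj hzn).1
    · exact .inr (hG.2 m z (by rwa [← hother hzn]))

theorem exists_dia {n : σ.Const} (h : dia φ ∈ G.T y) (hG : G.Supported U) (hn : n ∉ U) :
    ∃ H, G ≤ H ∧ (∀ x, (G.T x).Nonempty → H.T x = G.T x) ∧ φ ∈ H.T (n :: y) ∧
      H.Supported (insert n U) := by
  obtain ⟨H, h1, h2, h3, -, h4⟩ := exists_child h hG hn
  have hs := dia_mem_sent.1 (G.sent h)
  refine ⟨H, h1, h2, ?_, h4⟩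
  rw [h3]
  exact ⟨Sent.mono (G.dom_cons _ _) hs, ⟨top, (G.theory y ⟨_, h⟩).closed top_mem_sent .box_top⟩,
    .hyp (.inr rfl) hs.1⟩

/-- The new child realizes `◇⊤`, available by reflexivity, so its theory contains only what the
necessities at `y` imply. -/
theorem exists_box {n : σ.Const} (hy : (G.T y).Nonempty) (hs : box φ ∈ Sent (G.dom y))
    (h : box φ ∉ G.T y) (hG : G.Supported U) (hn : n ∉ U) :
    ∃ H, G ≤ H ∧ (H.T (n :: y)).Nonempty ∧ φ ∉ H.T (n :: y) ∧ H.Supported (insert n U) := by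
  have hT := G.theory y hy
  obtain ⟨H, h1, h2, h3, -, h4⟩ := exists_child (φ := top)
    (hT.closed (dia_mem_sent.2 top_mem_sent) (Der.dia_intro .top_intro)) hG hn
  refine ⟨H, h1, ?_, fun hφ => h ?_, h4⟩
  · rw [h3]
    exact ⟨top, top_mem_sent, ⟨top, hT.closed top_mem_sent .box_top⟩, .top_intro⟩
  · rw [h3] at hφ
    have hd : Der (∅ ∪ {β | box β ∈ G.T y}) φ := by
      refine hφ.2.2.cut ?_
      rintro θ (hθ | rfl) hs
      · exact .hyp (.inr hθ) hs
      · exact .top_intro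
    obtain ⟨β, hβ, hd⟩ := hT.exists_box hd
    exact hT.closed hs (.box_mono (box_mem_sent.1 (hT.sent hβ)).1 (hd.mono (by simp)) (hT.hyp hβ))

theorem bot_mem_root (h : bot ∈ G.T x) : bot ∈ G.T [] := by
  induction x with
  | nil => exact h
  | cons n x ih =>
    have h1 := G.dia_mem n x _ h bot_mem_sent
    exact ih ((G.theory x ⟨_, h1⟩).closed bot_mem_sent (.not_dia_bot (.hyp h1 rfl)))

/-- An inconsistency climbs to the root by `¬◇⊥` and descends to every active node through `□⊥`.
Omitting one sentence at one active node thus keeps the whole tree consistent. -/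
theorem mem_of_bot_mem (h : bot ∈ G.T y) (hx : (G.T x).Nonempty) (hφ : φ ∈ Sent (G.dom x)) :
    φ ∈ G.T x := by
  have hb : bot ∈ G.T x := by
    clear hφ
    induction x with
    | nil => exact bot_mem_root h
    | cons n x ih =>
      have h1 := ih (G.active n x hx)
      exact G.box_mem n x _ hx ((G.theory x ⟨_, h1⟩).closed bot_mem_sent
        (.ex_falso (.hyp h1 rfl) rfl))
  exact (G.theory x hx).closed hφ (.ex_falso (.hyp hb rfl) hφ.1)

/-- Every theory is prime, and all existential and possibility statements have witnesses. -/
structure Saturated (G : Fam σ) : Prop where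
  bot_notMem : ∀ x, bot ∉ G.T x
  or_mem : ∀ x φ ψ, Formula.or φ ψ ∈ G.T x → φ ∈ G.T x ∨ ψ ∈ G.T x
  ex_mem : ∀ x v φ, ex v φ ∈ G.T x → ∃ c ∈ G.dom x, φ.inst v c ∈ G.T x
  dia_mem : ∀ x φ, dia φ ∈ G.T x → ∃ n, φ ∈ G.T (n :: x)

/-! ### Limits of increasing sequences -/

theorem exists_sent_of_iUnion {D : ℕ → Set σ.Const} (hD : Monotone D)
    (h : φ ∈ Sent (⋃ n, D n)) : ∃ n, φ ∈ Sent (D n) := by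
  have h2 : ∀ c, ∃ n, φ.HasConst c → c ∈ D n := by
    intro c
    by_cases hc : φ.HasConst c
    · obtain ⟨n, hn⟩ := Set.mem_iUnion.1 (h.2 c hc)
      exact ⟨n, fun _ => hn⟩
    · exact ⟨0, fun h => (hc h).elim⟩
  choose f hf using h2
  obtain ⟨N, hN⟩ := (φ.finite_hasConst.image f).bddAbove
  exact ⟨N, h.1, fun c hc => hD (hN ⟨c, hc, rfl⟩) (hf c hc)⟩

theorem exists_der_of_iUnion {T : ℕ → Set (Formula σ)} (hT : Monotone T)
    (h : Der (⋃ n, T n) φ) : ∃ n, Der (T n) φ := by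
  induction h with
  | hyp h hs =>
    obtain ⟨n, hn⟩ := Set.mem_iUnion.1 h
    exact ⟨n, .hyp hn hs⟩
  | thm h => exact ⟨0, .thm h⟩
  | mp _ _ h1 h2 =>
    obtain ⟨n, h1⟩ := h1
    obtain ⟨m, h2⟩ := h2
    exact ⟨max n m, .mp (h1.mono (hT (le_max_left _ _))) (h2.mono (hT (le_max_right _ _)))⟩

/-- The union of an increasing sequence of families. -/
def iUnion (s : ℕ → Fam σ) (hs : Monotone s) : Fam σ where
  dom x := ⋃ n, (s n).dom x
  T x := ⋃ n, (s n).T x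
  dom_cons n x := Set.iUnion_mono fun k => (s k).dom_cons n x
  theory x hx := by
    have hD : Monotone fun n => (s n).dom x := fun _ _ h => (hs h).1 x
    have hT : Monotone fun n => (s n).T x := fun _ _ h => (hs h).2 x
    refine ⟨Set.iUnion_subset fun n φ hφ => Sent.mono (Set.subset_iUnion _ n) ((s n).sent hφ),
      fun {φ} hφ hd => ?_⟩
    obtain ⟨n, hn⟩ := exists_sent_of_iUnion hD hφ
    obtain ⟨m, hm⟩ := exists_der_of_iUnion hT hd
    obtain ⟨_, hx⟩ := hx
    obtain ⟨k, hk⟩ := Set.mem_iUnion.1 hx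
    have h1 : n ≤ max n (max m k) := le_max_left _ _
    have h2 : m ≤ max n (max m k) := (le_max_left _ _).trans (le_max_right _ _)
    have h3 : k ≤ max n (max m k) := (le_max_right _ _).trans (le_max_right _ _)
    exact Set.mem_iUnion.2 ⟨_, ((s _).theory x ⟨_, hT h3 hk⟩).closed (Sent.mono (hD h1) hn)
      (hm.mono (hT h2))⟩
  active n x hx := by
    obtain ⟨_, hx⟩ := hx
    obtain ⟨k, hk⟩ := Set.mem_iUnion.1 hx
    exact ((s k).active n x ⟨_, hk⟩).mono (Set.subset_iUnion (fun k => (s k).T x) k)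
  box_mem n x φ hx hφ := by
    obtain ⟨_, hx⟩ := hx
    obtain ⟨k, hk⟩ := Set.mem_iUnion.1 hx
    obtain ⟨m, hm⟩ := Set.mem_iUnion.1 hφ
    exact Set.mem_iUnion.2 ⟨max k m, (s _).box_mem n x φ ⟨_, (hs (le_max_left k m)).2 _ hk⟩
      ((hs (le_max_right k m)).2 _ hm)⟩
  dia_mem n x φ hφ hφs := by
    obtain ⟨k, hk⟩ := Set.mem_iUnion.1 hφ
    obtain ⟨m, hm⟩ := exists_sent_of_iUnion (fun _ _ h => (hs h).1 x) hφs
    exact Set.mem_iUnion.2 ⟨max k m, (s _).dia_mem n x φ ((hs (le_max_left k m)).2 _ hk)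
      (Sent.mono ((hs (le_max_right k m)).1 x) hm)⟩

theorem le_iUnion (s : ℕ → Fam σ) (hs : Monotone s) (n : ℕ) : s n ≤ iUnion s hs :=
  ⟨fun x => Set.subset_iUnion (fun k => (s k).dom x) n,
    fun x => Set.subset_iUnion (fun k => (s k).T x) n⟩

theorem supported_iUnion {s : ℕ → Fam σ} (hs : Monotone s) (h : ∀ n, (s n).Supported U) :
    (iUnion s hs).Supported U := by
  refine ⟨fun z => Set.iUnion_subset fun n => (h n).1 z, fun n z => ?_⟩
  rintro ⟨_, hz⟩
  obtain ⟨k, hk⟩ := Set.mem_iUnion.1 hz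
  exact (h k).2 n z ⟨_, hk⟩

/-! ### Saturation -/

variable (U B x χ) in
/-- The families that avoid `χ` at `x` and use finitely many elements of `B` besides `U`. -/
structure Avoids (G : Fam σ) : Prop where
  nonempty : (G.T x).Nonempty
  sent : χ ∈ Sent (G.dom x)
  notMem : χ ∉ G.T x
  supported : ∃ F : Set σ.Const, F.Finite ∧ F ⊆ B ∧ G.Supported (U ∪ F)

/-- The sentence of the request `r` of `G` has a witness in `H`. -/
structure Meets (G H : Fam σ) (r : List σ.Const × Formula σ) : Prop where
  or_mem : ∀ φ ψ, r.2 = .or φ ψ → .or φ ψ ∈ G.T r.1 → φ ∈ H.T r.1 ∨ ψ ∈ H.T r.1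
  ex_mem : ∀ v φ, r.2 = ex v φ → ex v φ ∈ G.T r.1 → ∃ c ∈ H.dom r.1, φ.inst v c ∈ H.T r.1
  dia_mem : ∀ φ, r.2 = dia φ → dia φ ∈ G.T r.1 → ∃ n, φ ∈ H.T (n :: r.1)

theorem Avoids.of_le {H : Fam σ} {F : Set σ.Const} (hG : G.Avoids U B x χ) (h : G ≤ H)
    (hH : χ ∉ H.T x) (hF : F.Finite) (hFB : F ⊆ B) (hs : H.Supported (U ∪ F)) :
    H.Avoids U B x χ :=
  ⟨hG.nonempty.mono (h.2 x), Sent.mono (h.1 x) hG.sent, hH, F, hF, hFB, hs⟩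

/-- One saturation step. It uses at most one new element of `B`, as a witness or as the label of a
child, so finiteness of the used part persists. -/
theorem Avoids.exists_meets (hB : B.Infinite) (hUB : Disjoint U B) (hG : G.Avoids U B x χ)
    (r : List σ.Const × Formula σ) : ∃ H, H.Avoids U B x χ ∧ G ≤ H ∧ Meets G H r := by
  obtain ⟨y, θ⟩ := r
  by_cases hθ : θ ∈ G.T y
  swap
  · refine ⟨G, hG, le_rfl, ?_, ?_, ?_⟩
    · rintro φ ψ rfl h; exact (hθ h).elim
    · rintro v φ rfl h; exact (hθ h).elim
    · rintro φ rfl h; exact (hθ h).elim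
  obtain ⟨F, hF, hFB, hs⟩ := hG.supported
  obtain ⟨b, hbB, hbF⟩ := hB.exists_notMem_finite hF
  have hb : b ∉ U ∪ F := by
    rintro (h | h)
    · exact Set.disjoint_left.1 hUB h hbB
    · exact hbF h
  have hins : insert b (U ∪ F) = U ∪ insert b F := by rw [Set.union_insert]
  cases θ with
  | or φ ψ =>
    obtain ⟨H, h1, h2, h3, h4⟩ := exists_or hθ hG.sent hG.notMem hs
    refine ⟨H, hG.of_le h1 h2 hF hFB h4, h1, ?_, by simp, by simp⟩
    rintro _ _ h -
    cases h
    exact h3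
  | ex v φ =>
    obtain ⟨H, h1, h2, h3, h4⟩ := exists_ex hθ hG.sent hG.notMem hs hb
    refine ⟨H, hG.of_le h1 h2 (hF.insert b) (Set.insert_subset hbB hFB) (hins ▸ h4), h1, by simp,
      ?_, by simp⟩
    rintro _ _ h -
    cases h
    exact ⟨b, h3⟩
  | dia φ =>
    obtain ⟨H, h1, h2, h3, h4⟩ := exists_dia hθ hs hb
    refine ⟨H, hG.of_le h1 ?_ (hF.insert b) (Set.insert_subset hbB hFB) (hins ▸ h4), h1, by simp,
      by simp, ?_⟩
    · rw [h2 x hG.nonempty]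
      exact hG.notMem
    · rintro _ h -
      cases h
      exact ⟨b, h3⟩
  | _ => exact ⟨G, hG, le_rfl, by simp, by simp, by simp⟩

/-- Half of the unused constants are spent on saturation; the other half stays unused for later
extensions of the resulting world. -/
theorem exists_infinite_split (hU : Uᶜ.Infinite) :
    ∃ B : Set σ.Const, B.Infinite ∧ Disjoint U B ∧ (U ∪ B)ᶜ.Infinite := by
  let e := hU.natEmbedding
  have he : Function.Injective fun n => (e n : σ.Const) :=
    Subtype.val_injective.comp e.injective
  refine ⟨Set.range fun n => (e (2 * n) : σ.Const),
    Set.infinite_range_of_injective fun a b h => by simpa using he h, ?_, ?_⟩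
  · rw [Set.disjoint_right]
    rintro _ ⟨n, rfl⟩
    exact (e _).2
  · refine (Set.infinite_range_of_injective (f := fun n => (e (2 * n + 1) : σ.Const))
      fun a b h => by simpa using he h).mono ?_
    rintro _ ⟨n, rfl⟩ (h | ⟨m, h⟩)
    · exact (e _).2 h
    · have := he h
      omega

/-- A family that avoids `χ` at `x` can be saturated. -/
theorem exists_saturated (hG : G.Supported U) (hU : Uᶜ.Infinite) (hx : (G.T x).Nonempty)
    (hχ : χ ∈ Sent (G.dom x)) (h : χ ∉ G.T x) :
    ∃ H, G ≤ H ∧ H.Saturated ∧ χ ∉ H.T x ∧ ∃ V, H.Supported V ∧ Vᶜ.Infinite := by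
  obtain ⟨B, hB, hUB, hV⟩ := exists_infinite_split hU
  have : Nonempty (Formula σ) := ⟨bot⟩
  obtain ⟨f, hf⟩ := exists_surjective_nat (List σ.Const × Formula σ)
  choose next hnext hle hmeets using
    fun (G : {G : Fam σ // G.Avoids U B x χ}) r => G.2.exists_meets hB hUB r
  let s : ℕ → {G : Fam σ // G.Avoids U B x χ} := fun n =>
    n.rec ⟨G, hx, hχ, h, ∅, Set.finite_empty, Set.empty_subset _, by simpa using hG⟩
      fun n H => ⟨next H (f n.unpair.1), hnext _ _⟩
  have hs : Monotone (fun n => (s n).1 : ℕ → Fam σ) := by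
    refine monotone_nat_of_le_succ fun n => ?_
    exact hle (s n) (f n.unpair.1)
  -- Stage `n` treats the request coded by the first component of `n.unpair`. Each request thus
  -- recurs at arbitrarily late stages, in particular after its sentence has entered the theory.
  have hmeet : ∀ r k, ∃ n, k ≤ n ∧ Meets (s n).1 (s (n + 1)).1 r := by
    intro r k
    obtain ⟨a, rfl⟩ := hf r
    refine ⟨Nat.pair a k, Nat.right_le_pair a k, ?_⟩
    have := hmeets (s (Nat.pair a k)) (f (Nat.pair a k).unpair.1)
    simp only [Nat.unpair_pair] at this
    convert this using 2
    simp
  have hreq : ∀ z θ, θ ∈ (iUnion _ hs).T z →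
      ∃ n, θ ∈ (s n).1.T z ∧ Meets (s n).1 (s (n + 1)).1 (z, θ) := by
    intro z θ hθ
    obtain ⟨k, hk⟩ := Set.mem_iUnion.1 hθ
    obtain ⟨n, hn, hm⟩ := hmeet (z, θ) k
    exact ⟨n, (hs hn).2 z hk, hm⟩
  have hχ' : χ ∉ (iUnion _ hs).T x := fun hmem => by
    obtain ⟨n, hn⟩ := Set.mem_iUnion.1 hmem
    exact (s n).2.notMem hn
  have hG' : G ≤ iUnion _ hs := le_iUnion _ hs 0
  have hle' := fun n => le_iUnion _ hs n
  refine ⟨iUnion _ hs, hG', ⟨fun z hz => hχ' ?_, fun z φ ψ hz => ?_, fun z v φ hz => ?_,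
    fun z φ hz => ?_⟩, hχ', U ∪ B, supported_iUnion hs fun n => ?_, hV⟩
  · exact mem_of_bot_mem hz (hx.mono (hG'.2 x)) (Sent.mono (hG'.1 x) hχ)
  · obtain ⟨n, hn, hm⟩ := hreq z _ hz
    exact (hm.or_mem φ ψ rfl hn).imp (fun h => (hle' (n + 1)).2 z h) fun h => (hle' (n + 1)).2 z h
  · obtain ⟨n, hn, hm⟩ := hreq z _ hz
    obtain ⟨c, hc, h⟩ := hm.ex_mem v φ rfl hn
    exact ⟨c, (hle' (n + 1)).1 z hc, (hle' (n + 1)).2 z h⟩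
  · obtain ⟨n, hn, hm⟩ := hreq z _ hz
    obtain ⟨m, h⟩ := hm.dia_mem φ rfl hn
    exact ⟨m, (hle' (n + 1)).2 _ h⟩
  · obtain ⟨F, -, hFB, hsupp⟩ := (s n).2.supported
    exact hsupp.mono (Set.union_subset_union_right U hFB)

end Fam

/-! ### Necessity and possibility along paths, by the S4 axioms -/

namespace Fam

variable {G : Fam σ} {x y : List σ.Const} {φ : Formula σ}

theorem dom_subset_of_suffix (h : x <:+ y) : G.dom x ⊆ G.dom y := by
  obtain ⟨l, rfl⟩ := h
  induction l with
  | nil => exact subset_rfl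
  | cons n l ih => exact ih.trans (G.dom_cons n _)

/-- `□φ → □□φ` carries the box itself down the path, and `□φ → φ` removes it at the end. -/
theorem mem_of_box_mem_of_suffix (h : x <:+ y) (hφ : box φ ∈ G.T x) (hy : (G.T y).Nonempty) :
    φ ∈ G.T y := by
  obtain ⟨l, rfl⟩ := h
  have : box φ ∈ G.T (l ++ x) := by
    induction l with
    | nil => exact hφ
    | cons n l ih =>
      have h1 := ih (G.active n _ hy)
      have hT := G.theory _ ⟨_, h1⟩
      exact G.box_mem n _ _ hy (hT.mem_of_der h1 (box_mem_sent.2 (hT.sent h1))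
        (Der.box_box (Der.self (hT.sent h1).1)))
  have hT := G.theory _ hy
  exact hT.mem_of_der this (box_mem_sent.1 (hT.sent this)) (Der.box_elim (Der.self (hT.sent this).1))

/-- `φ → ◇φ` introduces the diamond at `y`, and `◇◇φ → ◇φ` absorbs the one gained at each step up.
Since `φ` is over the domain of `x`, it is expressible all along the path. -/
theorem dia_mem_of_suffix (h : x <:+ y) (hφ : φ ∈ G.T y) (hs : φ ∈ Sent (G.dom x)) :
    dia φ ∈ G.T x := by
  obtain ⟨l, rfl⟩ := h
  have key : dia φ ∈ G.T (l ++ x) := by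
    have hT := G.theory _ ⟨_, hφ⟩
    exact hT.mem_of_der hφ (dia_mem_sent.2 (hT.sent hφ)) (Der.dia_intro (Der.self (hT.sent hφ).1))
  clear hφ
  induction l with
  | nil => exact key
  | cons n l ih =>
    refine ih ?_
    have hs' : φ ∈ Sent (G.dom (l ++ x)) := Sent.mono (dom_subset_of_suffix ⟨l, rfl⟩) hs
    have h1 := G.dia_mem n _ _ key (dia_mem_sent.2 hs')
    exact (G.theory _ ⟨_, h1⟩).mem_of_der h1 (dia_mem_sent.2 hs')
      (Der.dia_dia (Der.self (dia_mem_sent.2 (dia_mem_sent.2 hs')).1))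

end Fam

/-! ### The canonical model -/

/-- The worlds of the canonical model: the active nodes of the saturated families that leave
infinitely many constants unused and interpret each constant `c` by `j c`. -/
structure World (j : σ.Const → σ.Const) : Type u where
  fam : Fam σ
  node : List σ.Const
  saturated : fam.Saturated
  active : (fam.T node).Nonempty
  supported : ∃ V, fam.Supported V ∧ Vᶜ.Infinite
  range_subset : Set.range j ⊆ fam.dom []

namespace World

variable {j : σ.Const → σ.Const} (w : World j)

theorem ext' {w v : World j} (h1 : w.fam = v.fam) (h2 : w.node = v.node) : w = v := by
  cases w; cases v; cases h1; cases h2; rfl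

/-- The theory of a world. -/
def T : Set (Formula σ) := w.fam.T w.node

/-- The domain of a world. -/
def dom : Set σ.Const := w.fam.dom w.node

theorem theory : IsTheory w.dom w.T := w.fam.theory _ w.active

/-- The world at another active node of the same family. -/
def move (y : List σ.Const) (hy : (w.fam.T y).Nonempty) : World j :=
  { w with node := y, active := hy }

theorem const_mem (c : σ.Const) : j c ∈ w.dom :=
  Fam.dom_subset_of_suffix (List.nil_suffix) (w.range_subset ⟨c, rfl⟩)

/-- A family extending that of `w` and avoiding a sentence can be extended to a world. -/
theorem exists_world {H : Fam σ} {V : Set σ.Const} {y : List σ.Const} {χ : Formula σ}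
    (hH : w.fam ≤ H) (hV : H.Supported V) (hV' : Vᶜ.Infinite) (hy : (H.T y).Nonempty)
    (hχ : χ ∈ Sent (H.dom y)) (h : χ ∉ H.T y) :
    ∃ v : World j, v.node = y ∧ H ≤ v.fam ∧ χ ∉ v.T := by
  obtain ⟨K, hK, hs, hn, hU⟩ := Fam.exists_saturated hV hV' hy hχ h
  exact ⟨⟨K, y, hs, hy.mono (hK.2 y), hU, w.range_subset.trans ((hH.trans hK).1 [])⟩, rfl, hK, hn⟩

end World

theorem infinite_compl_insert {V : Set σ.Const} (hV : Vᶜ.Infinite) (c : σ.Const) :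
    (insert c V)ᶜ.Infinite := by
  have : (insert c V)ᶜ = Vᶜ \ {c} := by
    ext d
    simp [and_comm]
  rw [this]
  exact hV.sdiff (Set.finite_singleton c)

/-- The canonical model. -/
def canonicalModel (j : σ.Const → σ.Const) : Model σ where
  World := World j
  le w v := w.node = v.node ∧ w.fam ≤ v.fam
  rel w v := w.fam = v.fam ∧ w.node <:+ v.node
  le_refl _ := ⟨rfl, le_rfl⟩
  le_trans _ _ _ h h' := ⟨h.1.trans h'.1, h.2.trans h'.2⟩
  le_antisymm _ _ h h' := World.ext' (le_antisymm h.2 h'.2) h.1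
  -- Both confluence conditions take the missing corner in the larger family, at the node prescribed
  -- by the other two corners; it is active there because theories only grow.
  fc1 w v v' h h' := ⟨v'.move w.node (w.active.mono (le_of_eq_of_le h.1 h'.2 |>.2 w.node)),
    ⟨rfl, le_of_eq_of_le h.1 h'.2⟩, rfl, h.2.trans (h'.1 ▸ List.suffix_rfl)⟩
  fc2 w w' v h h' := ⟨w'.move v.node (v.active.mono ((h'.1 ▸ h.2 : v.fam ≤ w'.fam).2 v.node)),
    ⟨rfl, (h'.1 ▸ h.2 : v.fam ≤ w'.fam)⟩, rfl, (h.1 ▸ List.suffix_rfl : w'.node <:+ w.node).trans h'.2⟩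
  Elem := σ.Const
  dom w := w.dom
  dom_le w v h := by
    unfold World.dom
    rw [h.1]
    exact h.2.1 _
  dom_rel w v h := by
    unfold World.dom
    rw [h.1]
    exact Fam.dom_subset_of_suffix h.2
  eqv w a b := .eq (.const a) (.const b) ∈ w.T
  eqv_dom w a b h := eq_mem_sent.1 (w.theory.sent h)
  eqv_refl w a ha := w.theory.closed (eq_mem_sent.2 ⟨ha, ha⟩) (.eq_refl a)
  eqv_symm w a b h := w.theory.closed (eq_mem_sent.2 (eq_mem_sent.1 (w.theory.sent h)).symm)
    (w.theory.hyp h).eq_symm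
  eqv_trans w a b c h h' := w.theory.closed
    (eq_mem_sent.2 ⟨(eq_mem_sent.1 (w.theory.sent h)).1, (eq_mem_sent.1 (w.theory.sent h')).2⟩)
    ((w.theory.hyp h).eq_trans (w.theory.hyp h'))
  eqv_le w v a b h h' := by
    unfold World.T at *
    rw [← h.1]
    exact h.2.2 _ h'
  constI := j
  constI_mem c w := w.const_mem c
  predI w P := {a | .pred P (fun i => .const (a i)) ∈ w.T}
  predI_dom w P a h i := by
    have hs : Formula.pred P (fun i => .const (a i)) ∈ Sent w.dom := w.theory.sent h
    exact hs.2 (a i) ⟨i, rfl⟩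
  predI_le w v P h a h' := by
    change _ ∈ v.fam.T v.node
    rw [← h.1]
    exact h.2.2 _ h'
  predI_congr w P a b h h' := by
    refine w.theory.closed ⟨?_, ?_⟩ (Der.pred_congr (fun i => w.theory.hyp (h i)) (w.theory.hyp h'))
    · simp only [IsSentence, freeVars, Term.vars]
      exact Finset.eq_empty_of_forall_notMem (by simp)
    · rintro c ⟨i, hi⟩
      cases hi
      exact (eq_mem_sent.1 (w.theory.sent (h i))).2

theorem canonicalModel_mem_S4Frames (j : σ.Const → σ.Const) :
    (canonicalModel j).toFrame ∈ S4Frames :=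
  ⟨fun _ => ⟨rfl, List.suffix_rfl⟩, fun _ _ _ h h' => ⟨h.1.trans h'.1, h.2.trans h'.2⟩⟩

/-- The sentence with constants for elements that expresses `φ` under the assignment `g`. -/
def Formula.evalSentence (j : σ.Const → σ.Const) (g : ℕ → σ.Const) (φ : Formula σ) : Formula σ :=
  (φ.rename j).sub fun v => some (g v)

section evalSentence

variable {j : σ.Const → σ.Const} {g : ℕ → σ.Const} {φ : Formula σ}

theorem evalSentence_mem_sent (w : World j) (hg : ∀ v, g v ∈ w.dom) (φ : Formula σ) :
    φ.evalSentence j g ∈ Sent w.dom := by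
  refine ⟨Finset.eq_empty_of_forall_notMem fun v hv => ?_, fun c hc => ?_⟩
  · simpa using (mem_freeVars_sub hv).2
  · rcases hc.of_sub with h | ⟨v, hv⟩
    · obtain ⟨d, -, rfl⟩ := hasConst_rename.1 h
      exact w.const_mem d
    · cases hv
      exact hg v

theorem evalSentence_update (x : ℕ) (a : σ.Const) :
    ((φ.rename j).sub (Function.update (fun v => some (g v)) x none)).inst x a =
      φ.evalSentence j (Function.update g x a) := by
  rw [inst_sub, evalSentence]
  congr 1
  funext v
  by_cases hv : v = x <;> simp [Function.update, hv]

theorem evalSentence_of_isSentence (h : φ.IsSentence) : φ.evalSentence j g = φ.rename j :=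
  sub_eq_self fun v hv => by
    rw [show (φ.rename j).freeVars = ∅ from h.rename j] at hv
    simp at hv

theorem denote_canonicalModel (t : Term σ) :
    (t.rename j).sub (fun v => some (g v)) = .const ((canonicalModel j).denote g t) := by
  cases t <;> rfl

end evalSentence

/-- The truth lemma, by induction on `φ` for all worlds and assignments at once; elements of the
domain serve as their own names. -/
theorem forces_canonicalModel {j : σ.Const → σ.Const} (φ : Formula σ) (w : World j)
    (g : ℕ → σ.Const) (hg : ∀ v, g v ∈ w.dom) :
    (canonicalModel j).Forces w g φ ↔ φ.evalSentence j g ∈ w.T := by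
  have hle : ∀ {w v : World j}, w.node = v.node → w.fam ≤ v.fam → w.T ⊆ v.T ∧ w.dom ⊆ v.dom := by
    intro w v h1 h2
    unfold World.T World.dom
    rw [h1]
    exact ⟨h2.2 _, h2.1 _⟩
  have hupd : ∀ {w : World j} {g : ℕ → σ.Const} {x a}, (∀ v, g v ∈ w.dom) → a ∈ w.dom →
      ∀ v, Function.update g x a v ∈ w.dom := by
    intro w g x a hg ha v
    by_cases hv : v = x
    · subst hv; simpa using ha
    · simpa [hv] using hg v
  have hsent := fun (w : World j) g hg φ => evalSentence_mem_sent (g := g) w hg φ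
  induction φ generalizing w g with
  | pred P t =>
    simp only [evalSentence, rename, sub, denote_canonicalModel]
    rfl
  | eq s t =>
    simp only [evalSentence, rename, sub, denote_canonicalModel]
    rfl
  | bot => exact ⟨False.elim, w.saturated.bot_notMem _⟩
  | and φ ψ h1 h2 =>
    have hs := hsent w g hg (.and φ ψ)
    refine ⟨fun h => w.theory.and_mem ((h1 w g hg).1 h.1) ((h2 w g hg).1 h.2), fun h => ⟨?_, ?_⟩⟩
    · exact (h1 w g hg).2 (w.theory.closed (and_mem_sent.1 hs).1 (w.theory.hyp h).and_left)
    · exact (h2 w g hg).2 (w.theory.closed (and_mem_sent.1 hs).2 (w.theory.hyp h).and_right)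
  | or φ ψ h1 h2 =>
    have hs := hsent w g hg (.or φ ψ)
    have hs' := or_mem_sent.1 hs
    refine ⟨fun h => w.theory.closed hs (h.elim (fun h => ?_) fun h => ?_), fun h => ?_⟩
    · exact (w.theory.hyp ((h1 w g hg).1 h)).or_left hs'.2.1
    · exact .or_right hs'.1.1 (w.theory.hyp ((h2 w g hg).1 h))
    · exact (w.saturated.or_mem _ _ _ h).imp (h1 w g hg).2 (h2 w g hg).2
  | imp φ ψ h1 h2 =>
    have hs := hsent w g hg (.imp φ ψ)
    constructor
    · intro h
      by_contra hn
      obtain ⟨V, hV, hV'⟩ := w.supported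
      -- A refuting family at the same node is found first and then saturated without admitting `ψ`;
      -- its node is a world above `w`.
      obtain ⟨H, hH, hφ, hψ, hHV⟩ := Fam.exists_imp w.active hs hn hV
      obtain ⟨v, hv, hHv, hψv⟩ := w.exists_world hH hHV hV' ⟨_, hφ⟩
        (Sent.mono (hH.1 _) (imp_mem_sent.1 hs).2) hψ
      have hwv := hle hv.symm (hH.trans hHv)
      have hg' : ∀ x, g x ∈ v.dom := fun x => hwv.2 (hg x)
      refine hψv ((h2 v g hg').1 (h v ⟨hv.symm, hH.trans hHv⟩ ((h1 v g hg').2 ?_)))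
      unfold World.T
      rw [hv]
      exact hHv.2 _ hφ
    · intro h v hv hφ
      have hwv := hle hv.1 hv.2
      have hg' : ∀ x, g x ∈ v.dom := fun x => hwv.2 (hg x)
      exact (h2 v g hg').2 (v.theory.closed (imp_mem_sent.1 (hsent v g hg' (.imp φ ψ))).2
        (.mp (v.theory.hyp (hwv.1 h)) (v.theory.hyp ((h1 v g hg').1 hφ))))
  | box φ ih =>
    have hs := hsent w g hg (.box φ)
    constructor
    · intro h
      by_contra hn
      obtain ⟨V, hV, hV'⟩ := w.supported
      obtain ⟨n, hnV⟩ := hV'.nonempty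
      obtain ⟨H, hH, hne, hφ, hHV⟩ := Fam.exists_box w.active hs hn hV hnV
      obtain ⟨v, hv, hHv, hφv⟩ := w.exists_world hH hHV (infinite_compl_insert hV' n) hne
        (Sent.mono ((hH.1 _).trans (H.dom_cons _ _)) (box_mem_sent.1 hs)) hφ
      have hw' : (v.fam.T w.node).Nonempty := w.active.mono ((hH.trans hHv).2 _)
      have hsuf : w.node <:+ v.node := hv ▸ List.suffix_cons _ _
      have hg' : ∀ x, g x ∈ v.dom := fun x =>
        Fam.dom_subset_of_suffix hsuf ((hH.trans hHv).1 _ (hg x))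
      -- The clause for `□` looks first upwards and then along the modal relation: up to the old
      -- node in the enlarged family, then to its new child.
      exact hφv ((ih v g hg').1 (h (v.move w.node hw') v ⟨rfl, hH.trans hHv⟩ ⟨rfl, hsuf⟩))
    · intro h w' v hw' hv
      have hww := hle hw'.1 hw'.2
      have hwv : w'.dom ⊆ v.dom := (canonicalModel j).dom_rel w' v hv
      have hg' : ∀ x, g x ∈ v.dom := fun x => hwv (hww.2 (hg x))
      refine (ih v g hg').2 (Fam.mem_of_box_mem_of_suffix hv.2 ?_ v.active)
      rw [← hv.1]
      exact hww.1 h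
  | dia φ ih =>
    have hs := hsent w g hg (.dia φ)
    constructor
    · rintro ⟨v, hv, hφ⟩
      have hwv : w.dom ⊆ v.dom := (canonicalModel j).dom_rel w v hv
      have hg' : ∀ x, g x ∈ v.dom := fun x => hwv (hg x)
      refine Fam.dia_mem_of_suffix hv.2 ?_ (dia_mem_sent.1 hs)
      rw [hv.1]
      exact (ih v g hg').1 hφ
    · intro h
      obtain ⟨n, hn⟩ := w.saturated.dia_mem _ _ h
      have hsuf : w.node <:+ n :: w.node := List.suffix_cons _ _
      exact ⟨w.move (n :: w.node) ⟨_, hn⟩, ⟨rfl, hsuf⟩,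
        (ih (w.move _ ⟨_, hn⟩) g fun x => Fam.dom_subset_of_suffix hsuf (hg x)).2 hn⟩
  | all x φ ih =>
    have hs := hsent w g hg (.all x φ)
    constructor
    · intro h
      by_contra hn
      obtain ⟨V, hV, hV'⟩ := w.supported
      obtain ⟨c, hcV⟩ := hV'.nonempty
      obtain ⟨H, hH, hc, hφ, hHV⟩ := Fam.exists_all w.active hs hn hV hcV
      have hs' := inst_mem_sent (c := c) (isSentence_all.1 hs.1)
        (fun d hd => hH.1 _ (hs.2 d hd)) hc
      obtain ⟨v, hv, hHv, hφv⟩ := w.exists_world hH hHV (infinite_compl_insert hV' c)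
        (w.active.mono (hH.2 _)) hs' hφ
      have hwv := hle hv.symm (hH.trans hHv)
      have hcv : c ∈ v.dom := by
        unfold World.dom
        rw [hv]
        exact hHv.1 _ hc
      rw [evalSentence_update] at hφv
      exact hφv ((ih v _ (hupd (fun x => hwv.2 (hg x)) hcv)).1
        (h v ⟨hv.symm, hH.trans hHv⟩ c hcv))
    · intro h (v : World j) hv (a : σ.Const) ha
      have hwv := hle hv.1 hv.2
      have hg' := hupd (x := x) (fun x => hwv.2 (hg x)) ha
      refine (ih v _ hg').2 (v.theory.closed (hsent v _ hg' φ) ?_)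
      rw [← evalSentence_update]
      exact (v.theory.hyp (hwv.1 h)).all_elim a
  | ex x φ ih =>
    have hs := hsent w g hg (.ex x φ)
    constructor
    · rintro ⟨(a : σ.Const), ha, hφ⟩
      have h1 := (ih w _ (hupd hg ha)).1 hφ
      rw [← evalSentence_update] at h1
      exact w.theory.closed hs (w.theory.hyp h1).ex_intro
    · intro h
      obtain ⟨a, ha, hφ⟩ := w.saturated.ex_mem _ _ _ h
      rw [evalSentence_update] at hφ
      exact ⟨a, ha, (ih w _ (hupd hg ha)).2 hφ⟩

/-! ### Completeness -/

theorem exists_injective_compl_range_infinite (σ : Signature.{u}) :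
    ∃ j : σ.Const → σ.Const, Function.Injective j ∧ (Set.range j)ᶜ.Infinite := by
  obtain ⟨e⟩ : Nonempty (σ.Const ≃ ℕ) := nonempty_equiv_of_countable
  refine ⟨fun c => e.symm (2 * e c), fun a b h => by simpa using h, ?_⟩
  refine (Set.infinite_range_of_injective (f := fun n => e.symm (2 * n + 1))
    fun a b h => by simpa using h).mono ?_
  rintro _ ⟨n, rfl⟩ ⟨c, hc⟩
  have := e.symm.injective hc
  omega

/-- Theorems are stable under injective renamings, but a left inverse of `j` need not be injective.
On a finite set a permutation can take its place, built up by transpositions. -/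
theorem exists_perm_leftInverse {C : Type*} {j : C → C} (hj : Function.Injective j) {F : Set C}
    (hF : F.Finite) : ∃ e : Equiv.Perm C, ∀ c ∈ F, e (j c) = c := by
  classical
  induction F, hF using Set.Finite.induction_on with
  | empty => exact ⟨1, by simp⟩
  | @insert a F ha _ ih =>
    obtain ⟨e, he⟩ := ih
    refine ⟨e.trans (Equiv.swap (e (j a)) a), ?_⟩
    rintro c (rfl | hc)
    · simp
    · have hca : c ≠ a := fun h => ha (h ▸ hc)
      have : c ≠ e (j a) := by
        rw [← he c hc]
        exact fun h => hca (hj (e.injective (by rw [he c hc] at h ⊢; exact h)))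
      rw [Equiv.trans_apply, he c hc, Equiv.swap_apply_of_ne_of_ne this hca]

/-- Derivability is reflected by injective renamings of the constants. -/
theorem derivable_of_der_rename {j : σ.Const → σ.Const} (hj : Function.Injective j)
    {Γ : Set (Formula σ)} {φ : Formula σ} (h : Der (rename j '' Γ) (φ.rename j)) :
    Derivable (S4Axioms σ) Γ φ := by
  obtain ⟨l, hl, hd⟩ := h.exists_bigAnd
  have hl' : ∃ m : List (Formula σ), (∀ γ ∈ m, γ ∈ Γ) ∧ m.map (rename j) = l := by
    have : ∀ γ ∈ l, γ ∈ rename j '' Γ := fun γ hγ => (hl γ hγ).1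
    clear hd hl
    induction l with
    | nil => exact ⟨[], by simp⟩
    | cons γ l ih =>
      obtain ⟨m, hm, rfl⟩ := ih fun γ hγ => this γ (by simp [hγ])
      obtain ⟨γ, hγ, rfl⟩ := this γ (by simp)
      exact ⟨γ :: m, by simpa using ⟨hγ, hm⟩, rfl⟩
  obtain ⟨m, hm, rfl⟩ := hl'
  have hp := hd.provable_imp (Der.isSentence_bigAnd.2 fun γ hγ => (hl γ hγ).2)
  obtain ⟨e, he⟩ := exists_perm_leftInverse hj (imp (bigAnd m) φ).finite_hasConst
  have := hp.rename (fun _ => rename_mem_S4Axioms e) e.injective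
  rw [← rename_bigAnd] at this
  change Provable _ (((imp (bigAnd m) φ).rename j).rename e) at this
  rw [rename_rename, rename_eq_self (f := e ∘ j) he] at this
  exact ⟨m, hm, this⟩

/-- The family whose only active node is the root, with the consequences of `Γ` over `D`. -/
def rootFam (D : Set σ.Const) (Γ : Set (Formula σ)) : Fam σ where
  dom _ := D
  T x := {χ | x = [] ∧ χ ∈ Sent D ∧ Der Γ χ}
  dom_cons _ _ := subset_rfl
  theory x hx := by
    obtain ⟨_, rfl, -⟩ := hx
    exact ⟨fun _ h => h.2.1, fun h h' => ⟨rfl, h, h'.cut fun _ h _ => h.2.2⟩⟩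
  active n x hx := by
    obtain ⟨_, h, -⟩ := hx
    simp at h
  box_mem n x φ hx := by
    obtain ⟨_, h, -⟩ := hx
    simp at h
  dia_mem n x φ hφ := by simp at hφ

end FOFS

theorem mainTheorem8 (σ : FOFS.Signature.{u}) (Γ : Set (FOFS.Formula σ))
    (hΓ : ∀ γ ∈ Γ, γ.IsSentence) (φ : FOFS.Formula σ) (hφ : φ.IsSentence)
    (h : FOFS.Entails FOFS.S4Frames Γ φ) :
    FOFS.Derivable (FOFS.S4Axioms σ) Γ φ := by
  open FOFS in
  obtain ⟨j, hj, hinf⟩ := exists_injective_compl_range_infinite σ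
  by_contra hn
  have hsent : ∀ ψ : Formula σ, ψ.IsSentence → ψ.rename j ∈ Sent (Set.range j) := by
    refine fun ψ hψ => ⟨hψ.rename j, fun c hc => ?_⟩
    obtain ⟨d, -, rfl⟩ := Formula.hasConst_rename.1 hc
    exact ⟨d, rfl⟩
  have hsupp : (rootFam (Set.range j) (Formula.rename j '' Γ)).Supported (Set.range j) :=
    ⟨fun _ => subset_rfl, fun n z hz => by obtain ⟨_, hz, -⟩ := hz; simp at hz⟩
  -- The renamed `Γ` is placed at the root, the only active node, and the tree is saturated while
  -- the renamed `φ` is kept out of the root.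
  obtain ⟨H, hH, hs, hφH, hV⟩ := Fam.exists_saturated (x := []) (χ := φ.rename j) hsupp hinf
    ⟨Formula.top, rfl, top_mem_sent, .top_intro⟩ (hsent φ hφ)
    fun hφ' => hn (derivable_of_der_rename hj hφ'.2.2)
  let w : World j := ⟨H, [], hs, ⟨_, hH.2 [] ⟨rfl, top_mem_sent, .top_intro⟩⟩, hV, hH.1 []⟩
  have hholds : ∀ γ ∈ Γ, (canonicalModel j).Holds w γ := by
    intro γ hγ (g : ℕ → σ.Const) hg
    rw [forces_canonicalModel γ w g hg, evalSentence_of_isSentence (hΓ γ hγ)]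
    exact hH.2 [] ⟨rfl, hsent γ (hΓ γ hγ), .hyp ⟨γ, hγ, rfl⟩ ((hΓ γ hγ).rename j)⟩
  -- Some assignment into the domain is needed to apply the truth lemma to `φ`; any constant one
  -- with value in the range of `j` will do.
  have hc : ∀ v, (fun _ : ℕ => j (Classical.arbitrary σ.Const)) v ∈ w.dom := fun _ => w.const_mem _
  have := h (canonicalModel j) (canonicalModel_mem_S4Frames j) w hholds _ hc
  rw [forces_canonicalModel φ w _ hc, evalSentence_of_isSentence hφ] at this
  exact hφH this
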